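/- **Theorem.** Let $\mathcal H$ be a complex Hilbert space. (1) Let $\mathcal A$ be a von Neumann algebra on $\mathcal H$ with a cyclic and separating vector $\Omega$, and let $\check S$ be the Tomita operator of $(\mathcal A,\Omega)$, i.e. the closure of the antilinear operator $A\Omega\mapsto A^*\Omega$, $A\in\mathcal A$. For every vector $\Phi$ in the domain of $\check S$ there is a closed, densely defined operator $F$ affiliated with $\mathcal A$ (i.e. $BF\subseteq FB$ for every $B\in\mathcal A'$) such that $\Omega$ lies in the domains of $F$ and of $F^*$ and $$F\Omega=\Phi,\qquad F^*\Omega=\check S\Phi .$$ (2) Consider Minkowski space of dimension $1+d$, $d\ge 1$; a wedge is an image of $\{x : x^1>|x^0|\}$ under a Poincaré transformation. Let there be given: a von Neumann algebra $\mathcal A(W)$ on $\mathcal H$ for every wedge $W$, with $\mathcal A(W_1)\subseteq\mathcal A(W_2)$ if $W_1\subseteq W_2$; a strongly continuous unitary representation $U(a)=e^{iP\cdot a}$ of the translations with $U(a)\mathcal A(W)U(a)^*=\mathcal A(W+a)$ for every wedge $W$ and with the spectrum of $P$ in the closed forward light cone; and a unit vector $\Omega$ (the vacuum), which is up to scalars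 the only $U$-invariant vector and is cyclic and separating for every $\mathcal A(W)$. For $m\ge 0$ let $\mathcal H^{(1)}_m$ be the one-particle space of mass $m$: the vectors orthogonal to $\Omega$ in the spectral subspace of $P$ for the mass shell $\{p : p^0\ge 0,\ p^2=m^2\}$ (for $m>0$ the orthogonality to $\Omega$ is automatic). A polarization-free generator (PFG) for $W$ and $m$ is a closed, densely defined operator $G$ affiliated with $\mathcal A(W)$ such that $\Omega$ lies in the domains of $G$ and of $G^*$, and $G\Omega$ and $G^*\Omega$ lie in $\mathcal H^{(1)}_m$. Then for every wedge $W$ and every $m\ge 0$, with $\check S_W$ the Tomita operator of $(\mathcal A(W),\Omega)$: the vectors of $\mathcal H^{(1)}_m$ that lie in the domain of $\check S_W$ are dense in $\mathcal H^{(1)}_m$, and for each such vector $\Phi$ there is a PFG $G$ for $W$ and $m$ with $G\Omega=\Phi$ and $G^*\Omega=\check S_W\Phi$. -/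

import Mathlib

open scoped LinearPMap SchwartzMap InnerProductSpace

/-! ### Modular theory of a von Neumann algebra with a cyclic and separating vector -/

section Modular

variable {H : Type*} [NormedAddCommGroup H] [InnerProductSpace ℂ H] [CompleteSpace H]

/-- `Ω` is cyclic for `M`: the vectors `A Ω`, `A ∈ M`, are dense. -/
def IsCyclicVector (M : VonNeumannAlgebra H) (Ω : H) : Prop :=
  Dense {x : H | ∃ A ∈ M, A Ω = x}

/-- `Ω` is separating for `M`: `A Ω = 0` with `A ∈ M` only for `A = 0`. -/
def IsSeparatingVector (M : VonNeumannAlgebra H) (Ω : H) : Prop :=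
  ∀ A ∈ M, A Ω = 0 → A = 0

/-- The set of pairs `(A Ω, A* Ω)`, `A ∈ M`, as a real-linear subspace of `H × H`. -/
def preTomitaGraph (M : VonNeumannAlgebra H) (Ω : H) : Submodule ℝ (H × H) where
  carrier := {p | ∃ A ∈ M, p = (A Ω, (star A) Ω)}
  zero_mem' := ⟨0, zero_mem M, by simp; rfl⟩
  add_mem' := by
    rintro _ _ ⟨A, hA, rfl⟩ ⟨B, hB, rfl⟩
    exact ⟨A + B, add_mem hA hB, by simp [star_add]⟩
  smul_mem' := by
    rintro c _ ⟨A, hA, rfl⟩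
    refine ⟨(c : ℂ) • A, M.toStarSubalgebra.smul_mem hA (c : ℂ), ?_⟩
    simp [star_smul, Complex.coe_smul]

/-- The operator `A Ω ↦ A* Ω` with domain `M Ω`. It is antilinear, and is regarded here as a
real-linear partially defined operator. -/
noncomputable def preTomita (M : VonNeumannAlgebra H) (Ω : H) : H →ₗ.[ℝ] H :=
  (preTomitaGraph M Ω).toLinearPMap

/-- The Tomita operator of `(M, Ω)`: the closure of `A Ω ↦ A* Ω`, `A ∈ M`. -/
noncomputable def tomitaOperator (M : VonNeumannAlgebra H) (Ω : H) : H →ₗ.[ℝ] H :=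
  (preTomita M Ω).closure

/-- The operator `F` is affiliated with `M`: `B F ⊆ F B` for every `B` in the commutant of `M`. -/
def IsAffiliated (F : H →ₗ.[ℂ] H) (M : VonNeumannAlgebra H) : Prop :=
  ∀ B ∈ M.commutant, ∀ x : F.domain, ∃ h : B (x : H) ∈ F.domain, F ⟨B (x : H), h⟩ = B (F x)

end Modular

/-! ### Minkowski space and wedges -/

/-- Minkowski space of dimension `1 + (n + 1)`; the coordinate `0` is time, the coordinate `1` is
the spatial direction of the standard wedge. Only the vector space structure, the topology and the
Lebesgue measure of this space are used; the geometry is that of `minkowski`. -/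
abbrev Spacetime (n : ℕ) : Type := EuclideanSpace ℝ (Fin (n + 2))

/-- The Lorentzian product `x⁰ y⁰ - x¹ y¹ - ⋯`. -/
def minkowski {n : ℕ} (x y : Spacetime n) : ℝ :=
  x 0 * y 0 - ∑ i : Fin (n + 1), x i.succ * y i.succ

/-- The standard wedge `{x | x¹ > |x⁰|}`. -/
def standardWedge (n : ℕ) : Set (Spacetime n) := {x | |x 0| < x 1}

/-- A wedge: an image of the standard wedge under a Poincaré transformation `x ↦ Λ x + a`. -/
def IsWedge {n : ℕ} (W : Set (Spacetime n)) : Prop :=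
  ∃ (L : Spacetime n ≃ₗ[ℝ] Spacetime n) (a : Spacetime n),
    (∀ x y, minkowski (L x) (L y) = minkowski x y) ∧ W = (fun x => L x + a) '' standardWedge n

/-- The closed forward light cone (in momentum space). -/
def forwardCone (n : ℕ) : Set (Spacetime n) := {p | 0 ≤ p 0 ∧ 0 ≤ minkowski p p}

/-- The mass shell `{p | p⁰ ≥ 0, p² = m²}`. -/
def massShell (n : ℕ) (m : ℝ) : Set (Spacetime n) := {p | 0 ≤ p 0 ∧ minkowski p p = m ^ 2}

/-! ### Theories of wedge algebras -/

section Wedges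

variable {H : Type*} [NormedAddCommGroup H] [InnerProductSpace ℂ H] [CompleteSpace H] {n : ℕ}

/-- For a strongly continuous unitary representation `U(a) = exp(i P · a)` of the translations and a
closed set `C` of momenta: the vector `ψ` lies in the range of the spectral projection of the
energy-momentum operators `P` for `C`, i.e. `f(U) ψ = ∫ f(a) U(a) ψ da` vanishes for every Schwartz
function `f` whose Fourier transform `p ↦ ∫ f(a) exp(i p · a) da` vanishes on `C`. -/
def HasMomentumIn (U : Spacetime n → unitary (H →L[ℂ] H)) (C : Set (Spacetime n)) (ψ : H) : Prop :=
  ∀ f : 𝓢(Spacetime n, ℂ),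
    (∀ p ∈ C, ∫ a, f a * Complex.exp (Complex.I * (minkowski p a : ℂ)) = 0) →
      ∫ a, f a • (U a : H →L[ℂ] H) ψ = 0

/-- A translation covariant theory of wedge algebras in the vacuum representation. -/
structure WedgeTheory (n : ℕ) (H : Type*) [NormedAddCommGroup H] [InnerProductSpace ℂ H]
    [CompleteSpace H] where
  /-- The wedge algebras; only the values at wedges are relevant. -/
  alg : Set (Spacetime n) → VonNeumannAlgebra H
  /-- The representation of the translations. -/
  U : Spacetime n → unitary (H →L[ℂ] H)
  /-- The vacuum vector. -/
  Ω : H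
  isotony : ∀ W₁ W₂, IsWedge W₁ → IsWedge W₂ → W₁ ⊆ W₂ → alg W₁ ≤ alg W₂
  U_add : ∀ a b, U (a + b) = U a * U b
  U_continuous : ∀ ψ : H, Continuous fun a => (U a : H →L[ℂ] H) ψ
  covariance : ∀ W, IsWedge W → ∀ (a : Spacetime n) (A : H →L[ℂ] H),
    A ∈ alg W ↔ (U a : H →L[ℂ] H) * A * star (U a : H →L[ℂ] H) ∈ alg ((fun x => x + a) '' W)
  spectrum : ∀ ψ : H, HasMomentumIn U (forwardCone n) ψ
  Ω_norm : ‖Ω‖ = 1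
  Ω_invariant : ∀ a, (U a : H →L[ℂ] H) Ω = Ω
  Ω_unique : ∀ ψ : H, (∀ a, (U a : H →L[ℂ] H) ψ = ψ) → ∃ c : ℂ, ψ = c • Ω
  cyclic : ∀ W, IsWedge W → IsCyclicVector (alg W) Ω
  separating : ∀ W, IsWedge W → IsSeparatingVector (alg W) Ω

namespace WedgeTheory

/-- The one-particle space of mass `m`: the vectors orthogonal to the vacuum whose
energy-momentum lies on the mass shell. (For `m > 0` the orthogonality is automatic.) -/
def oneParticle (T : WedgeTheory n H) (m : ℝ) : Set H :=
  {ψ | HasMomentumIn T.U (massShell n m) ψ ∧ ⟪T.Ω, ψ⟫_ℂ = 0}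

/-- The closed (densely defined) operator `G` is a polarization-free generator for the wedge `W`
and the mass `m`. -/
structure IsPFG (T : WedgeTheory n H) (W : Set (Spacetime n)) (m : ℝ) (G : H →ₗ.[ℂ] H) : Prop where
  dense : Dense (G.domain : Set H)
  closed : G.IsClosed
  affiliated : IsAffiliated G (T.alg W)
  mem_domain : T.Ω ∈ G.domain
  mem_adjoint_domain : T.Ω ∈ G†.domain
  apply_mem : G ⟨T.Ω, mem_domain⟩ ∈ T.oneParticle m
  adjoint_apply_mem : G† ⟨T.Ω, mem_adjoint_domain⟩ ∈ T.oneParticle m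

end WedgeTheory

end Wedges

/-! Modular part. For `A ∈ M` and `C ∈ M'` one has `⟪C Ω, A Ω⟫ = ⟪A* Ω, C* Ω⟫`, and this relation
survives the closure: every pair `(Φ, Ψ)` in the graph of the Tomita operator satisfies `⟪C Ω, Φ⟫ =
⟪Ψ, C* Ω⟫`. Let `F` be the closure of `C Ω ↦ C Φ`, `C ∈ M'`. It is densely defined because a
separating vector of `M` is cyclic for `M'`. Replacing `C` by `C* D` in the relation gives `⟪D Ψ, C
Ω⟫ = ⟪D Ω, C Φ⟫`, which yields closability and, for `D = 1`, `F* Ω = Ψ`. Affiliation holds because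
multiplication by `B ∈ M'` preserves the graph (`exists_affiliated_of_mem_tomitaGraph`).

Wedge part. What remains is that the spectral projection `E` of the mass shell maps the graph of the
Tomita operator `S` into itself (`spectralApply_massShell_mem_tomitaGraph`). Then `E Φ = Φ` forces
`E S Φ = S Φ`, so `S` preserves the one-particle space, and projecting vectors `B Ω`, `B ∈ alg W`,
gives the density.

For the invariance, translations mapping `W` into itself act diagonally on the graph. The functions
`G` of the momentum for which `(x, y) ↦ (G(P) x, G(P) y)` preserves the graph form an algebra that
is closed under bounded pointwise limits, but only a real one, since `S` is antilinear, and not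
visibly closed under conjugation, since lightlike translations into `W` form only half-lines. With
`u = p⁰ - p¹`, `v = p⁰ + p¹` it contains `exp(i t u)` and `exp(-i t v)` for `t ≥ 0`, and `exp(i t
w)` for the transverse momenta `w` and all real `t`. Laplace-type limits give the resolvents `(ε - i
u)⁻¹` and `(ε + i v)⁻¹`, whose product tends to the inverse of `u v`; the opposite signs make the
result real, and `u v ≥ 0` by the spectrum condition. Hence `(1 + u v)⁻¹` and `(1 + Σ w²)⁻¹` lie in
the algebra, and from these real functions one obtains the indicator of `u v - Σ w² = m²`
(`IsBoundedlyClosed.indicator_mem`).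

The functional calculus `g(P) x` is built vector by vector: Bochner's theorem gives the spectral
measure of `x`, and `character a ↦ U(a) x` extends to `L²` of any finite measure dominating it. -/

/-! ### Affiliated operators from the graph of the Tomita operator -/

section Modular

variable {H : Type*} [NormedAddCommGroup H] [InnerProductSpace ℂ H] [CompleteSpace H]

/-- The orbit `M Ω` of a vector under a von Neumann algebra. -/
def VonNeumannAlgebra.orbit (M : VonNeumannAlgebra H) (Ω : H) : Submodule ℂ H where
  carrier := {x | ∃ A ∈ M, A Ω = x}
  zero_mem' := ⟨0, zero_mem M, by simp⟩
  add_mem' := by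
    rintro _ _ ⟨A, hA, rfl⟩ ⟨B, hB, rfl⟩
    exact ⟨A + B, add_mem hA hB, by simp⟩
  smul_mem' := by
    rintro c _ ⟨A, hA, rfl⟩
    exact ⟨c • A, M.toStarSubalgebra.smul_mem hA c, by simp⟩

/-- A separating vector of `M` is cyclic for the commutant of `M`. -/
theorem IsSeparatingVector.isCyclicVector_commutant {M : VonNeumannAlgebra H} {Ω : H}
    (h : IsSeparatingVector M Ω) : IsCyclicVector M.commutant Ω := by
  set K := (M.commutant.orbit Ω).topologicalClosure with hK
  have hinv : ∀ y ∈ M.commutant, ∀ x ∈ K, y x ∈ K := by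
    intro y hy x hx
    refine map_mem_closure y.continuous hx ?_
    rintro _ ⟨A, hA, rfl⟩
    exact ⟨y * A, mul_mem hy hA, rfl⟩
  have : CompleteSpace K := (Submodule.isClosed_topologicalClosure _).completeSpace_coe
  -- The commutant leaves `K` invariant, so the projection onto `K` lies in `M'' = M`. Its
  -- complement annihilates `Ω`, hence is zero.
  have he : K.starProjection ∈ M := by
    rw [VonNeumannAlgebra.IsStarProjection.mem_iff (isStarProjection_starProjection)]
    intro y hy x hx
    have hr : K.starProjection.range = K := by simp
    simp only [hr] at hx ⊢
    exact hinv y hy x hx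
  have hΩ : Ω ∈ K := subset_closure ⟨1, one_mem _, rfl⟩
  have h1 : (1 : H →L[ℂ] H) - K.starProjection = 0 := by
    refine h _ (sub_mem (one_mem M) he) ?_
    simp [Submodule.starProjection_eq_self_iff.2 hΩ]
  intro x
  have : K.starProjection x = x := by
    have := congrArg (fun T : H →L[ℂ] H => T x) h1
    simp only [sub_apply, one_apply_eq_self,
      zero_apply] at this
    exact (sub_eq_zero.1 this).symm
  exact Submodule.starProjection_eq_self_iff.1 this

/-- The closure of the graph of `A Ω ↦ A* Ω`. -/
noncomputable def tomitaGraph (M : VonNeumannAlgebra H) (Ω : H) : Submodule ℝ (H × H) :=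
  (preTomitaGraph M Ω).topologicalClosure

theorem isClosed_tomitaGraph (M : VonNeumannAlgebra H) (Ω : H) :
    IsClosed (tomitaGraph M Ω : Set (H × H)) :=
  Submodule.isClosed_topologicalClosure _

/-- For `p = (A Ω, A* Ω)` this is the commutation of `A` with `star C`; both sides are continuous in
`p`, so it persists on the closure. -/
theorem inner_commutant_of_mem_tomitaGraph {M : VonNeumannAlgebra H} {Ω : H} {p : H × H}
    (hp : p ∈ tomitaGraph M Ω) {C : H →L[ℂ] H} (hC : C ∈ M.commutant) :
    ⟪C Ω, p.1⟫_ℂ = ⟪p.2, star C Ω⟫_ℂ := by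
  have hcl : IsClosed {p : H × H | ⟪C Ω, p.1⟫_ℂ = ⟪p.2, star C Ω⟫_ℂ} :=
    isClosed_eq (by fun_prop) (by fun_prop)
  refine closure_minimal ?_ hcl hp
  rintro _ ⟨A, hA, rfl⟩
  have h1 : A (star C Ω) = star C (A Ω) :=
    congrArg (fun T : H →L[ℂ] H => T Ω)
      (VonNeumannAlgebra.mem_commutant_iff.1 (star_mem hC) A hA)
  simp only [Set.mem_ofPred_eq]
  rw [ContinuousLinearMap.star_eq_adjoint, ContinuousLinearMap.star_eq_adjoint,
    ContinuousLinearMap.adjoint_inner_left, ← ContinuousLinearMap.star_eq_adjoint, h1,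
    ContinuousLinearMap.star_eq_adjoint, ContinuousLinearMap.adjoint_inner_right]

/-- The second component is orthogonal to the dense set `M' Ω`. This is the closability of `A Ω ↦ A*
Ω`. -/
theorem snd_eq_zero_of_mem_tomitaGraph {M : VonNeumannAlgebra H} {Ω : H}
    (hs : IsSeparatingVector M Ω) {p : H × H} (hp : p ∈ tomitaGraph M Ω) (h0 : p.1 = 0) :
    p.2 = 0 := by
  refine hs.isCyclicVector_commutant.eq_zero_of_inner_left (𝕜 := ℂ) ?_
  rintro _ ⟨C, hC, rfl⟩
  have := inner_commutant_of_mem_tomitaGraph hp (star_mem hC)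
  rw [h0, inner_zero_right, star_star] at this
  exact this.symm

/-- `Submodule.toLinearPMap` and `LinearPMap.closure` have the intended meaning only for
single-valued and closable input; the separating property supplies both, after which only the closed
graph matters. -/
theorem tomitaOperator_graph {M : VonNeumannAlgebra H} {Ω : H} (hs : IsSeparatingVector M Ω) :
    (tomitaOperator M Ω).graph = tomitaGraph M Ω := by
  have h1 : (preTomita M Ω).graph = preTomitaGraph M Ω :=
    Submodule.toLinearPMap_graph_eq _ fun x hx h0 =>
      snd_eq_zero_of_mem_tomitaGraph hs (subset_closure hx) h0
  have h2 : (preTomita M Ω).IsClosable :=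
    ⟨(tomitaGraph M Ω).toLinearPMap, by
      rw [h1, Submodule.toLinearPMap_graph_eq _ fun x hx h0 =>
        snd_eq_zero_of_mem_tomitaGraph hs hx h0]
      rfl⟩
  rw [tomitaOperator, ← h2.graph_closure_eq_closure_graph, h1, tomitaGraph]

/-- The graph `{(C Ω, C Φ) | C ∈ M'}`. -/
def commutantGraph (M : VonNeumannAlgebra H) (Ω Φ : H) : Submodule ℂ (H × H) where
  carrier := {p | ∃ C ∈ M.commutant, p = (C Ω, C Φ)}
  zero_mem' := ⟨0, zero_mem _, by simp; rfl⟩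
  add_mem' := by
    rintro _ _ ⟨A, hA, rfl⟩ ⟨B, hB, rfl⟩
    exact ⟨A + B, add_mem hA hB, by simp⟩
  smul_mem' := by
    rintro c _ ⟨A, hA, rfl⟩
    exact ⟨c • A, M.commutant.toStarSubalgebra.smul_mem hA c, by simp⟩

/-- The relation for the Tomita graph is applied to `C* D`. In effect `D Ω` lies in the domain of
`F*` with `F* D Ω = D Ψ`: density of the vectors `D Ω` makes `F` single-valued, and `D = 1` computes
`F* Ω`. -/
theorem inner_of_mem_closure_commutantGraph {M : VonNeumannAlgebra H} {Ω Φ Ψ : H}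
    (hΦ : (Φ, Ψ) ∈ tomitaGraph M Ω) {p : H × H}
    (hp : p ∈ (commutantGraph M Ω Φ).topologicalClosure) {D : H →L[ℂ] H}
    (hD : D ∈ M.commutant) : ⟪D Ψ, p.1⟫_ℂ = ⟪D Ω, p.2⟫_ℂ := by
  have hcl : IsClosed {p : H × H | ⟪D Ψ, p.1⟫_ℂ = ⟪D Ω, p.2⟫_ℂ} :=
    isClosed_eq (by fun_prop) (by fun_prop)
  refine closure_minimal ?_ hcl hp
  rintro _ ⟨C, hC, rfl⟩
  have h := inner_commutant_of_mem_tomitaGraph hΦ (mul_mem (star_mem hC) hD)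
  simp only [star_mul, star_star] at h
  change ⟪star C (D Ω), Φ⟫_ℂ = ⟪Ψ, star D (C Ω)⟫_ℂ at h
  simp only [Set.mem_ofPred_eq]
  rw [ContinuousLinearMap.star_eq_adjoint, ContinuousLinearMap.adjoint_inner_left,
    ContinuousLinearMap.star_eq_adjoint, ContinuousLinearMap.adjoint_inner_right] at h
  exact h.symm

/-- Every pair in the graph of the Tomita operator is of the form `(F Ω, F* Ω)` with a closed
operator `F` affiliated with `M`. -/
theorem exists_affiliated_of_mem_tomitaGraph {M : VonNeumannAlgebra H} {Ω Φ Ψ : H}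
    (hs : IsSeparatingVector M Ω) (hΦ : (Φ, Ψ) ∈ tomitaGraph M Ω) :
    ∃ F : H →ₗ.[ℂ] H, Dense (F.domain : Set H) ∧ F.IsClosed ∧ IsAffiliated F M ∧
      ∃ (h : Ω ∈ F.domain) (h' : Ω ∈ F†.domain), F ⟨Ω, h⟩ = Φ ∧ F† ⟨Ω, h'⟩ = Ψ := by
  set G := (commutantGraph M Ω Φ).topologicalClosure with hG
  have hgraph : G.toLinearPMap.graph = G := by
    refine Submodule.toLinearPMap_graph_eq _ fun x hx h0 => ?_
    refine hs.isCyclicVector_commutant.eq_zero_of_inner_right (𝕜 := ℂ) ?_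
    rintro _ ⟨D, hD, rfl⟩
    have := inner_of_mem_closure_commutantGraph hΦ hx hD
    rw [h0, inner_zero_right] at this
    exact this.symm
  have hmem : ∀ x : G.toLinearPMap.domain, ((x : H), G.toLinearPMap x) ∈ G := fun x => by
    have := G.toLinearPMap.mem_graph x
    rwa [hgraph] at this
  have happ : ∀ p ∈ G, ∃ h : p.1 ∈ G.toLinearPMap.domain, G.toLinearPMap ⟨p.1, h⟩ = p.2 := by
    intro p hp
    rw [← hgraph] at hp
    obtain ⟨y, hy1, hy2⟩ := (LinearPMap.mem_graph_iff _).1 hp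
    have hd : p.1 ∈ G.toLinearPMap.domain := hy1 ▸ y.2
    refine ⟨hd, ?_⟩
    rw [← hy2]
    congr 1
    exact Subtype.ext hy1.symm
  have hdense : Dense (G.toLinearPMap.domain : Set H) := by
    refine hs.isCyclicVector_commutant.mono ?_
    rintro _ ⟨C, hC, rfl⟩
    exact (happ (C Ω, C Φ) (subset_closure ⟨C, hC, rfl⟩)).1
  obtain ⟨hΩ, hFΩ⟩ := happ (Ω, Φ) (subset_closure ⟨1, one_mem _, rfl⟩)
  have hadj : ∀ x : G.toLinearPMap.domain, ⟪Ψ, (x : H)⟫_ℂ = ⟪Ω, G.toLinearPMap x⟫_ℂ := fun x => by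
    simpa using inner_of_mem_closure_commutantGraph hΦ (hmem x) (one_mem M.commutant)
  refine ⟨G.toLinearPMap, hdense, ?_, ?_, hΩ,
    LinearPMap.mem_adjoint_domain_of_exists _ ⟨Ψ, hadj⟩, hFΩ,
    LinearPMap.adjoint_apply_eq hdense _ hadj⟩
  · rw [LinearPMap.IsClosed, hgraph]
    exact Submodule.isClosed_topologicalClosure _
  · intro B hB x
    have : (B x, B (G.toLinearPMap x)) ∈ G := by
      refine map_mem_closure (f := fun p : H × H => (B p.1, B p.2)) (by fun_prop) (hmem x) ?_
      rintro _ ⟨C, hC, rfl⟩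
      exact ⟨B * C, mul_mem hB hC, rfl⟩
    exact happ _ this

theorem mem_tomitaGraph_of_domain {M : VonNeumannAlgebra H} {Ω : H}
    (hs : IsSeparatingVector M Ω) (Φ : (tomitaOperator M Ω).domain) :
    ((Φ : H), tomitaOperator M Ω Φ) ∈ tomitaGraph M Ω := by
  rw [← tomitaOperator_graph hs]
  exact (tomitaOperator M Ω).mem_graph Φ

theorem mem_domain_of_mem_tomitaGraph {M : VonNeumannAlgebra H} {Ω : H}
    (hs : IsSeparatingVector M Ω) {p : H × H} (hp : p ∈ tomitaGraph M Ω) :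
    p.1 ∈ (tomitaOperator M Ω).domain := by
  rw [← tomitaOperator_graph hs] at hp
  exact LinearPMap.mem_domain_of_mem_graph hp

end Modular

/-! ### Real function algebras closed under bounded limits: from phases to the indicator of a
hyperboloid -/

section FunctionAlgebra

open Filter Topology

/-- A real algebra of complex functions, bounded on `C` and closed under bounded pointwise limits
on `C`. -/
structure IsBoundedlyClosed {X : Type*} (C : Set X) (𝒢 : Subalgebra ℝ (X → ℂ)) : Prop where
  bounded : ∀ G ∈ 𝒢, ∃ K : ℝ, ∀ p ∈ C, ‖G p‖ ≤ K
  lim : ∀ (F : ℕ → X → ℂ) (G : X → ℂ) (K : ℝ), (∀ k, F k ∈ 𝒢) → (∀ k, ∀ p ∈ C, ‖F k p‖ ≤ K) →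
    (∀ p ∈ C, Tendsto (fun k => F k p) atTop (𝓝 (G p))) → G ∈ 𝒢

namespace IsBoundedlyClosed

variable {X : Type*} {C : Set X} {𝒢 : Subalgebra ℝ (X → ℂ)}

theorem congr (h : IsBoundedlyClosed C 𝒢) {F G : X → ℂ} (hF : F ∈ 𝒢)
    (hFG : ∀ p ∈ C, F p = G p) : G ∈ 𝒢 := by
  obtain ⟨K, hK⟩ := h.bounded F hF
  refine h.lim (fun _ => F) G K (fun _ => hF) (fun _ => hK) fun p hp => ?_
  rw [hFG p hp]
  exact tendsto_const_nhds

theorem const_mem (𝒢 : Subalgebra ℝ (X → ℂ)) (c : ℝ) : (fun _ => (c : ℂ)) ∈ 𝒢 :=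
  𝒢.algebraMap_mem c

/-- Functions with real part bounded from below by a positive constant are invertible. -/
theorem inv_mem (h : IsBoundedlyClosed C 𝒢) {G : X → ℂ} (hG : G ∈ 𝒢) {c : ℝ} (hc : 0 < c)
    (hcG : ∀ p ∈ C, c ≤ (G p).re) : (fun p => (G p)⁻¹) ∈ 𝒢 := by
  obtain ⟨K', hK'⟩ := h.bounded G hG
  obtain ⟨K, hKc, hK⟩ : ∃ K, c ≤ K ∧ ∀ p ∈ C, ‖G p‖ ≤ K :=
    ⟨max c K', le_max_left _ _, fun p hp => (hK' p hp).trans (le_max_right _ _)⟩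
  have hK0 : 0 < K := hc.trans_le hKc
  -- With this scale `|1 - t G|² ≤ 1 - 2 t Re G + t c < 1`, so the Neumann series of `(t G)⁻¹`
  -- converges pointwise; its partial sums times `t` equal `(1 - (1 - t G)ᵏ) / G`, bounded by `2 /
  -- c`.
  set t : ℝ := c / K ^ 2 with ht
  have ht0 : 0 < t := by positivity
  have hlt : ∀ p ∈ C, ‖1 - (t : ℂ) * G p‖ < 1 := by
    intro p hp
    have h1 : Complex.normSq (1 - (t : ℂ) * G p) =
        1 - 2 * t * (G p).re + t ^ 2 * Complex.normSq (G p) := by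
      simp only [Complex.normSq_apply, Complex.sub_re, Complex.sub_im, Complex.one_re,
        Complex.one_im, Complex.re_ofReal_mul, Complex.im_ofReal_mul]
      ring
    have h2 : Complex.normSq (G p) ≤ K ^ 2 := by
      rw [Complex.normSq_eq_norm_sq]
      exact pow_le_pow_left₀ (norm_nonneg _) (hK p hp) 2
    have h3 : t ^ 2 * Complex.normSq (G p) ≤ t * c := by
      calc t ^ 2 * Complex.normSq (G p) ≤ t ^ 2 * K ^ 2 := by gcongr
        _ = t * c := by rw [ht]; field_simp
    have h4 : t * c ≤ t * (G p).re := by gcongr; exact hcG p hp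
    have h5 : 0 < t * c := by positivity
    rw [← sq_lt_one_iff₀ (norm_nonneg _), ← Complex.normSq_eq_norm_sq, h1]
    linarith
  have hG0 : ∀ p ∈ C, c ≤ ‖G p‖ := fun p hp =>
    (hcG p hp).trans ((le_abs_self _).trans (Complex.abs_re_le_norm _))
  have hne : ∀ p ∈ C, G p ≠ 0 := fun p hp h0 => by
    have := hG0 p hp
    rw [h0, norm_zero] at this
    linarith
  have hsum : ∀ p ∈ C, ∀ k : ℕ, (t : ℂ) * ∑ i ∈ Finset.range k, (1 - (t : ℂ) * G p) ^ i =
      (1 - (1 - (t : ℂ) * G p) ^ k) * (G p)⁻¹ := by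
    intro p hp k
    have := mul_neg_geom_sum (1 - (t : ℂ) * G p) k
    rw [eq_mul_inv_iff_mul_eq₀ (hne p hp), ← this]
    ring
  refine h.lim (fun k p => (t : ℂ) * ∑ i ∈ Finset.range k, (1 - (t : ℂ) * G p) ^ i) _ (2 / c)
    (fun k => ?_) (fun k p hp => ?_) fun p hp => ?_
  · have h1 : (fun _ => (t : ℂ)) * ∑ i ∈ Finset.range k, (1 - (fun _ => (t : ℂ)) * G) ^ i ∈ 𝒢 :=
      mul_mem (const_mem 𝒢 t) (sum_mem fun i _ => pow_mem
        (sub_mem (one_mem 𝒢) (mul_mem (const_mem 𝒢 t) hG)) i)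
    convert! h1 using 1
    ext p
    simp
  · rw [hsum p hp k, norm_mul, norm_inv, div_eq_mul_inv]
    gcongr
    · refine (norm_sub_le _ _).trans ?_
      rw [norm_one, norm_pow]
      have := pow_le_one₀ (n := k) (norm_nonneg _) (hlt p hp).le
      linarith
    · exact hG0 p hp
  · simp_rw [hsum p hp]
    have h1 := (tendsto_const_nhds (x := (1 : ℂ))).sub
      (tendsto_pow_atTop_nhds_zero_of_norm_lt_one (hlt p hp))
    simpa using h1.mul_const (G p)⁻¹

/-- The resolvent of the generator of a one-parameter semigroup of phases. -/
theorem resolvent_mem (h : IsBoundedlyClosed C 𝒢) {s : X → ℝ}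
    (hs : ∀ t : ℝ, 0 ≤ t → (fun p => Complex.exp (Complex.I * ((t * s p : ℝ) : ℂ))) ∈ 𝒢)
    {ε : ℝ} (hε : 0 < ε) : (fun p => ((ε : ℂ) - Complex.I * s p)⁻¹) ∈ 𝒢 := by
  set τ : ℕ → ℝ := fun k => 1 / ((k : ℝ) + 1) with hτ
  have hτ0 : ∀ k, 0 < τ k := fun k => by positivity
  -- `G k / τ k` is a difference quotient converging to `ε - i s`. The term `ε τ k` keeps the real
  -- part positive, so `G k` can be inverted within the algebra.
  set G : ℕ → X → ℂ := fun k p =>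
    ((1 + ε * τ k : ℝ) : ℂ) - Complex.exp (Complex.I * ((τ k * s p : ℝ) : ℂ)) with hG
  have hGmem : ∀ k, G k ∈ 𝒢 := fun k => sub_mem (const_mem 𝒢 _) (hs _ (hτ0 k).le)
  have hre : ∀ k p, ε * τ k ≤ (G k p).re := by
    intro k p
    have h1 : (Complex.exp (Complex.I * ((τ k * s p : ℝ) : ℂ))).re ≤ 1 := by
      refine (Complex.re_le_norm _).trans ?_
      rw [mul_comm, Complex.norm_exp_ofReal_mul_I]
    simp only [hG, Complex.sub_re, Complex.ofReal_re]
    linarith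
  refine h.lim (fun k p => (τ k : ℂ) * (G k p)⁻¹) _ (1 / ε)
    (fun k => mul_mem (const_mem 𝒢 _) (h.inv_mem (hGmem k) (mul_pos hε (hτ0 k))
      fun p _ => hre k p)) (fun k p _ => ?_) fun p _ => ?_
  · have h1 : ε * τ k ≤ ‖G k p‖ := (hre k p).trans (Complex.re_le_norm _)
    have h2 : 0 < ε * τ k := mul_pos hε (hτ0 k)
    rw [norm_mul, norm_inv, Complex.norm_real, Real.norm_of_nonneg (hτ0 k).le,
      ← div_eq_mul_inv, div_le_div_iff₀ (h2.trans_le h1) hε]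
    linarith
  · have hlim : Tendsto τ atTop (𝓝[≠] 0) := by
      refine tendsto_nhdsWithin_iff.2 ⟨tendsto_one_div_add_atTop_nhds_zero_nat,
        Eventually.of_forall fun k => (hτ0 k).ne'⟩
    have hd : HasDerivAt (fun t : ℝ => ((1 + ε * t : ℝ) : ℂ) -
        Complex.exp (Complex.I * ((t * s p : ℝ) : ℂ))) ((ε : ℂ) - Complex.I * s p) 0 := by
      have h1 : HasDerivAt (fun t : ℝ => ((1 + ε * t : ℝ) : ℂ)) (ε : ℂ) 0 := by
        have := ((hasDerivAt_id (0 : ℝ)).const_mul ε).const_add 1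
        simpa using this.ofReal_comp
      have h2 : HasDerivAt (fun t : ℝ => Complex.I * ((t * s p : ℝ) : ℂ))
          (Complex.I * s p) 0 := by
        have := ((hasDerivAt_id (0 : ℝ)).mul_const (s p)).ofReal_comp.const_mul Complex.I
        simpa using this
      have h3 := h2.cexp
      simp only [zero_mul, Complex.ofReal_zero, mul_zero, Complex.exp_zero, one_mul] at h3
      exact h1.sub h3
    have hsl := (hasDerivAt_iff_tendsto_slope.1 hd).comp hlim
    have hne : ((ε : ℂ) - Complex.I * s p) ≠ 0 := fun h0 => by
      have := congrArg Complex.re h0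
      simp at this
      exact hε.ne' this
    refine (hsl.inv₀ hne).congr fun k => ?_
    simp only [Function.comp, slope, vsub_eq_sub, sub_zero, zero_mul, mul_zero, add_zero,
      Complex.ofReal_zero, Complex.exp_zero, Complex.ofReal_one, sub_self, hG]
    rw [Complex.real_smul, mul_inv, Complex.ofReal_inv, inv_inv]

/-- The resolvent of the product `u v ≥ 0` of the generators of two semigroups of phases. -/
theorem inv_one_add_mul_mem (h : IsBoundedlyClosed C 𝒢) {u v : X → ℝ}
    (hu : ∀ t : ℝ, 0 ≤ t → (fun p => Complex.exp (Complex.I * ((t * u p : ℝ) : ℂ))) ∈ 𝒢)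
    (hv : ∀ t : ℝ, 0 ≤ t → (fun p => Complex.exp (Complex.I * ((t * (-v p) : ℝ) : ℂ))) ∈ 𝒢)
    (huv : ∀ p ∈ C, 0 ≤ u p * v p) : (fun p => ((1 + u p * v p : ℝ) : ℂ)⁻¹) ∈ 𝒢 := by
  set τ : ℕ → ℝ := fun k => 1 / ((k : ℝ) + 1) with hτ
  have hτ0 : ∀ k, 0 < τ k := fun k => by positivity
  -- Here `z = τ² + u v + i τ (v - u)`, which tends to `u v` and has real part at least `τ²` on `C`.
  -- It may be unbounded; only its inverse, a product of two resolvents, is known to lie in the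
  -- algebra.
  set z : ℕ → X → ℂ := fun k p =>
    ((τ k : ℂ) - Complex.I * u p) * ((τ k : ℂ) - Complex.I * ((-v p : ℝ) : ℂ)) with hz
  have hzre : ∀ k, ∀ p ∈ C, 0 < (z k p).re := by
    intro k p hp
    have : (z k p).re = τ k ^ 2 + u p * v p := by simp [hz]; ring
    rw [this]
    have := huv p hp
    have := hτ0 k
    positivity
  have hA : ∀ k, (fun p => (z k p)⁻¹) ∈ 𝒢 := fun k => by
    have h1 := mul_mem (h.resolvent_mem hu (hτ0 k)) (h.resolvent_mem hv (hτ0 k))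
    refine h.congr h1 fun p _ => ?_
    simp only [Pi.mul_apply, hz, mul_inv]
  have hre : ∀ k, ∀ p ∈ C, 1 ≤ (1 + (z k p)⁻¹).re := by
    intro k p hp
    rw [Complex.add_re, Complex.one_re, Complex.inv_re]
    have := div_nonneg (hzre k p hp).le (Complex.normSq_nonneg (z k p))
    linarith
  -- `(1 + z)⁻¹ = z⁻¹ (1 + z⁻¹)⁻¹`, where `1 + z⁻¹` is bounded with real part at least `1`.
  have hB : ∀ k, (fun p => (1 + z k p)⁻¹) ∈ 𝒢 := fun k => by
    have h1 := mul_mem (hA k) (h.inv_mem (G := fun p => 1 + (z k p)⁻¹)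
      (add_mem (one_mem 𝒢) (hA k)) one_pos (hre k))
    refine h.congr h1 fun p hp => ?_
    have hz0 : z k p ≠ 0 := fun h0 => by
      have := hzre k p hp
      simp [h0] at this
    simp only [Pi.mul_apply]
    rw [← mul_inv, mul_add, mul_one, mul_inv_cancel₀ hz0, add_comm]
  refine h.lim _ _ 1 hB (fun k p hp => ?_) fun p hp => ?_
  · rw [norm_inv]
    refine inv_le_one_of_one_le₀ (le_trans ?_ (Complex.re_le_norm _))
    have := hzre k p hp
    simp only [Complex.add_re, Complex.one_re]
    linarith
  · have hlim : Tendsto (fun k => (τ k : ℂ)) atTop (𝓝 ((0 : ℝ) : ℂ)) :=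
      (Complex.continuous_ofReal.tendsto 0).comp tendsto_one_div_add_atTop_nhds_zero_nat
    have h1 : Tendsto (fun k => 1 + z k p) atTop (𝓝 ((1 + u p * v p : ℝ) : ℂ)) := by
      have := ((hlim.sub_const (Complex.I * u p)).mul
        (hlim.sub_const (Complex.I * ((-v p : ℝ) : ℂ)))).const_add 1
      convert! this using 2
      push_cast
      linear_combination ((u p : ℂ) * v p) * Complex.I_sq
    refine h1.inv₀ ?_
    have := huv p hp
    exact_mod_cast (by positivity : (1 + u p * v p) ≠ 0)

/-- The resolvent of the sum of the squares of the generators of groups of phases. -/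
theorem inv_one_add_sum_sq_mem (h : IsBoundedlyClosed C 𝒢) {ι : Type*} [Fintype ι]
    {w : ι → X → ℝ}
    (hw : ∀ j, ∀ t : ℝ, (fun p => Complex.exp (Complex.I * ((t * w j p : ℝ) : ℂ))) ∈ 𝒢) :
    (fun p => ((1 + ∑ j, w j p ^ 2 : ℝ) : ℂ)⁻¹) ∈ 𝒢 := by
  set δ : ℕ → ℝ := fun k => (k : ℝ) + 1 with hδ
  have hδ0 : ∀ k, 0 < δ k := fun k => by positivity
  -- A bounded truncation of `w²`, equal to `δ² (1 - δ² / (δ² + w²))`, where `(δ² + w²)⁻¹` is the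
  -- product of the resolvents of `w` and `-w`.
  set a : ℕ → ι → X → ℝ := fun k j p => w j p ^ 2 / (1 + w j p ^ 2 / δ k ^ 2) with ha
  have ha0 : ∀ k j p, 0 ≤ a k j p := fun k j p => by have := hδ0 k; positivity
  have hamem : ∀ k j, (fun p => (a k j p : ℂ)) ∈ 𝒢 := fun k j => by
    have h1 := h.resolvent_mem (fun t _ => hw j t) (hδ0 k)
    have h2 := h.resolvent_mem (s := fun p => -w j p)
      (fun t _ => by simpa using hw j (-t)) (hδ0 k)
    have h3 := mul_mem (const_mem 𝒢 (δ k ^ 2)) (sub_mem (one_mem 𝒢)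
      (mul_mem (const_mem 𝒢 (δ k ^ 2)) (mul_mem h1 h2)))
    refine h.congr h3 fun p _ => ?_
    have hd := hδ0 k
    have e1 : ((δ k : ℂ) - Complex.I * w j p)⁻¹ * ((δ k : ℂ) - Complex.I * ((-w j p : ℝ) : ℂ))⁻¹ =
        (((δ k ^ 2 + w j p ^ 2)⁻¹ : ℝ) : ℂ) := by
      rw [← mul_inv, Complex.ofReal_inv]
      congr 1
      push_cast
      linear_combination (-(w j p : ℂ) ^ 2) * Complex.I_sq
    simp only [Pi.mul_apply, Pi.sub_apply, Pi.one_apply, e1, ha]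
    norm_cast
    field_simp
    ring
  have hmem : ∀ k, (fun p => ((1 + ∑ j, a k j p : ℝ) : ℂ)⁻¹) ∈ 𝒢 := fun k => by
    refine h.inv_mem (c := 1) ?_ one_pos fun p _ => ?_
    · have := add_mem (one_mem 𝒢) (sum_mem fun j (_ : j ∈ Finset.univ) => hamem k j)
      convert! this using 1
      ext p
      simp
    · rw [Complex.ofReal_re]
      have := Finset.sum_nonneg fun j (_ : j ∈ Finset.univ) => ha0 k j p
      linarith
  refine h.lim _ _ 1 hmem (fun k p _ => ?_) fun p _ => ?_
  · rw [norm_inv]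
    refine inv_le_one_of_one_le₀ (le_trans ?_ (Complex.re_le_norm _))
    rw [Complex.ofReal_re]
    have := Finset.sum_nonneg fun j (_ : j ∈ Finset.univ) => ha0 k j p
    linarith
  · have hlim : Tendsto (fun k => 1 + ∑ j, a k j p) atTop (𝓝 (1 + ∑ j, w j p ^ 2)) := by
      refine tendsto_const_nhds.add (tendsto_finsetSum _ fun j _ => ?_)
      have h1 : Tendsto (fun k => δ k ^ 2) atTop atTop :=
        (tendsto_pow_atTop two_ne_zero).comp
          (tendsto_atTop_add_const_right _ _ tendsto_natCast_atTop_atTop)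
      have h2 : Tendsto (fun k => 1 + w j p ^ 2 / δ k ^ 2) atTop (𝓝 1) := by
        simpa using (h1.const_div_atTop (w j p ^ 2)).const_add 1
      have h3 := (tendsto_const_nhds (x := w j p ^ 2)).div h2 one_ne_zero
      rwa [div_one] at h3
    refine ((Complex.continuous_ofReal.tendsto _).comp hlim).inv₀ ?_
    have : 0 ≤ ∑ j, w j p ^ 2 := by positivity
    exact_mod_cast (by positivity : (1 + ∑ j, w j p ^ 2) ≠ 0)

/-- The spectral projection for the hyperboloid `u v - Σ w² = c`. -/
theorem indicator_mem (h : IsBoundedlyClosed C 𝒢) {ι : Type*} [Fintype ι]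
    {u v : X → ℝ} {w : ι → X → ℝ}
    (hu : ∀ t : ℝ, 0 ≤ t → (fun p => Complex.exp (Complex.I * ((t * u p : ℝ) : ℂ))) ∈ 𝒢)
    (hv : ∀ t : ℝ, 0 ≤ t → (fun p => Complex.exp (Complex.I * ((t * (-v p) : ℝ) : ℂ))) ∈ 𝒢)
    (hw : ∀ j, ∀ t : ℝ, (fun p => Complex.exp (Complex.I * ((t * w j p : ℝ) : ℂ))) ∈ 𝒢)
    (huv : ∀ p ∈ C, 0 ≤ u p * v p) (c : ℝ) :
    Set.indicator {p | u p * v p - ∑ j, w j p ^ 2 = c} (1 : X → ℂ) ∈ 𝒢 := by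
  set R : X → ℝ := fun p => (1 + u p * v p)⁻¹ with hR
  set D : X → ℝ := fun p => (1 + ∑ j, w j p ^ 2)⁻¹ with hD
  have hRm : (fun p => (R p : ℂ)) ∈ 𝒢 := by
    simpa [hR] using h.inv_one_add_mul_mem hu hv huv
  have hDm : (fun p => (D p : ℂ)) ∈ 𝒢 := by
    simpa [hD] using h.inv_one_add_sum_sq_mem hw
  -- A polynomial in `R` and `D` that equals `(u v - Σ w² - c) R D` on `C`: a bounded function with
  -- the same zeros as `u v - Σ w² - c`.
  set q : X → ℝ := fun p => (1 - R p) * D p - R p * (1 - D p) - c * (R p * D p) with hq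
  have hqm : (fun p => (q p : ℂ)) ∈ 𝒢 := by
    have h1 := sub_mem (sub_mem (mul_mem (sub_mem (one_mem 𝒢) hRm) hDm)
      (mul_mem hRm (sub_mem (one_mem 𝒢) hDm))) (mul_mem (const_mem 𝒢 c) (mul_mem hRm hDm))
    convert! h1 using 1
    ext p
    simp [hq]
  have hq0 : ∀ p ∈ C, (q p = 0 ↔ u p * v p - ∑ j, w j p ^ 2 = c) := by
    intro p hp
    have h1 : 0 < 1 + u p * v p := by have := huv p hp; positivity
    have h2 : 0 < 1 + ∑ j, w j p ^ 2 := by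
      have : 0 ≤ ∑ j, w j p ^ 2 := by positivity
      positivity
    have h3 : q p = (u p * v p - ∑ j, w j p ^ 2 - c) * (R p * D p) := by
      simp only [hq, hR, hD]
      field_simp
      ring
    rw [h3, mul_eq_zero, sub_eq_zero]
    have h4 : R p * D p ≠ 0 := mul_ne_zero (inv_ne_zero h1.ne') (inv_ne_zero h2.ne')
    simp [h4]
  obtain ⟨K', hK'⟩ := h.bounded _ hqm
  obtain ⟨K, hK0, hK⟩ : ∃ K, 0 < K ∧ ∀ p ∈ C, |q p| ≤ K :=
    ⟨max 1 K', by positivity, fun p hp => by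
      have := hK' p hp
      rw [Complex.norm_real, Real.norm_eq_abs] at this
      exact this.trans (le_max_right _ _)⟩
  have hle : ∀ p ∈ C, q p ^ 2 / K ^ 2 ≤ 1 := fun p hp => by
    rw [div_le_one (by positivity), ← sq_abs]
    exact pow_le_pow_left₀ (abs_nonneg _) (hK p hp) 2
  -- On `C` the base lies in `[0, 1]` and equals `1` exactly where `q = 0`, so its powers converge
  -- to the indicator of the zero set.
  refine h.lim (fun k p => (((1 - q p ^ 2 / K ^ 2) ^ k : ℝ) : ℂ)) _ 1 (fun k => ?_)
    (fun k p hp => ?_) fun p hp => ?_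
  · have h1 := pow_mem (sub_mem (one_mem 𝒢)
      (mul_mem (const_mem 𝒢 (K ^ 2)⁻¹) (pow_mem hqm 2))) k
    convert! h1 using 1
    ext p
    simp [div_eq_inv_mul]
  · rw [Complex.norm_real, Real.norm_of_nonneg (pow_nonneg (sub_nonneg.2 (hle p hp)) k)]
    exact pow_le_one₀ (sub_nonneg.2 (hle p hp)) (by have : 0 ≤ q p ^ 2 / K ^ 2 := by positivity
                                                    linarith)
  · by_cases hp0 : u p * v p - ∑ j, w j p ^ 2 = c
    · rw [Set.indicator_of_mem (by exact hp0)]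
      simp [(hq0 p hp).2 hp0]
    · rw [Set.indicator_of_notMem (by exact hp0)]
      have hqn : q p ≠ 0 := fun h0 => hp0 ((hq0 p hp).1 h0)
      have h1 : 0 < q p ^ 2 / K ^ 2 := by positivity
      have h2 := tendsto_pow_atTop_nhds_zero_of_lt_one (sub_nonneg.2 (hle p hp))
        (by linarith : 1 - q p ^ 2 / K ^ 2 < 1)
      simpa [Function.comp_def] using (Complex.continuous_ofReal.tendsto _).comp h2

end IsBoundedlyClosed

end FunctionAlgebra

/-! ### Inner products and norms under unitaries -/

section UnitaryRep

variable {H : Type*} [NormedAddCommGroup H] [InnerProductSpace ℂ H] [CompleteSpace H]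

theorem inner_unitary_apply {V : Type*} [Add V] {U : V → unitary (H →L[ℂ] H)} (hadd : ∀ a b, U (a + b) = U a * U b)
    (a b : V) (x y : H) : ⟪(U a : H →L[ℂ] H) x, (U (a + b) : H →L[ℂ] H) y⟫_ℂ =
      ⟪x, (U b : H →L[ℂ] H) y⟫_ℂ := by
  rw [hadd]
  exact Unitary.linearIsometryEquiv (U a) |>.inner_map_map x ((U b : H →L[ℂ] H) y)

theorem norm_unitary_apply (u : unitary (H →L[ℂ] H)) (x : H) : ‖(u : H →L[ℂ] H) x‖ = ‖x‖ :=
  (Unitary.linearIsometryEquiv u).norm_map x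

end UnitaryRep

/-! ### Bochner's theorem for matrix elements of unitary representations -/

section Bochner

open MeasureTheory Filter Topology Complex
open scoped FourierTransform

variable {V : Type*} [NormedAddCommGroup V] [InnerProductSpace ℝ V] [FiniteDimensional ℝ V]
  [MeasurableSpace V] [BorelSpace V]

theorem integrable_exp_neg_mul_sq_norm {β : ℝ} (hβ : 0 < β) :
    Integrable fun w : V => Real.exp (-β * ‖w‖ ^ 2) := by
  have := (GaussianFourier.integrable_cexp_neg_mul_sq_norm_add (V := V) (b := (β : ℝ))
    (by rwa [ofReal_re]) 0 0).norm
  refine this.congr (ae_of_all _ fun w => ?_)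
  simp only [Complex.norm_exp]
  congr 1
  norm_cast
  simp

/-- A continuous integrable function with nonnegative Fourier transform has integrable Fourier
transform. -/
theorem integrable_of_fourier_eq_nonneg {f : V → ℂ} (hc : Continuous f) (hf : Integrable f)
    {ρ : V → ℝ} (hρ : ∀ p, 𝓕 f p = ρ p) (hρ0 : ∀ p, 0 ≤ ρ p) : Integrable ρ := by
  have hFc : Continuous (𝓕 f) :=
    VectorFourier.fourierIntegral_continuous Real.continuous_fourierChar
      (by exact continuous_inner) hf
  have hρc : Continuous ρ := by
    have : ρ = fun p => (𝓕 f p).re := by ext p; rw [hρ, ofReal_re]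
    rw [this]
    exact continuous_re.comp hFc
  have hb : ∀ p, ‖ρ p‖ ≤ ∫ v, ‖f v‖ := fun p => by
    have := VectorFourier.norm_fourierIntegral_le_integral_norm Real.fourierChar volume
      (innerₗ V) f p
    change ‖𝓕 f p‖ ≤ _ at this
    rwa [hρ, Complex.norm_real] at this
  have hint : ∀ c : ℝ, 0 < c → Integrable fun w : V => Real.exp (-c⁻¹ * ‖w‖ ^ 2) * ρ w :=
    fun c hc0 => (integrable_exp_neg_mul_sq_norm (inv_pos.2 hc0)).mul_bdd (c := ∫ v, ‖f v‖) hρc.aestronglyMeasurable (ae_of_all _ hb)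
  -- Moving the Fourier transform onto the Gaussian turns these integrals into an approximate
  -- identity applied to `f` at `0`. Since `ρ ≥ 0`, Fatou's lemma then bounds the integral of `ρ` by
  -- `f 0`.
  have hlim : Tendsto (fun c : ℝ => ∫ w : V, Real.exp (-c⁻¹ * ‖w‖ ^ 2) * ρ w) atTop
      (𝓝 (f 0).re) := by
    have h1 := Real.tendsto_integral_gaussian_smul' hf (v := 0) hc.continuousAt
    have h2 := (continuous_re.tendsto _).comp h1
    refine h2.congr' ?_
    filter_upwards [Ioi_mem_atTop 0] with c (hc0 : 0 < c)
    have J : Integrable (fun w : V => cexp (-(c⁻¹ : ℝ) * ‖w‖ ^ 2)) := by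
      simpa using GaussianFourier.integrable_cexp_neg_mul_sq_norm_add (V := V) (b := (c⁻¹ : ℝ))
        (by rw [ofReal_re]; positivity) 0 0
    have h3 := VectorFourier.integral_fourierIntegral_smul_eq_flip (L := innerₗ V)
      Real.continuous_fourierChar continuous_inner J hf
    have h4 : ∀ w : V, VectorFourier.fourierIntegral Real.fourierChar volume (innerₗ V)
        (fun w : V => cexp (-(c⁻¹ : ℝ) * ‖w‖ ^ 2)) w =
        (Real.pi * c : ℂ) ^ (Module.finrank ℝ V / 2 : ℂ) *
          cexp (-Real.pi ^ 2 * c * ‖(0 : V) - w‖ ^ 2) := by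
      intro w
      have := fourier_gaussian_innerProductSpace (V := V) (b := (c⁻¹ : ℝ))
        (by rw [ofReal_re]; positivity) w
      change 𝓕 (fun w : V => cexp (-(c⁻¹ : ℝ) * ‖w‖ ^ 2)) w = _
      rw [this]
      push_cast
      rw [div_inv_eq_mul, zero_sub, norm_neg, div_inv_eq_mul]
      ring_nf
    have h5 : ∀ w : V, VectorFourier.fourierIntegral Real.fourierChar volume (innerₗ V).flip f w
        = ρ w := by
      intro w
      rw [← hρ, flip_innerₗ]
      rfl
    simp only [h4, h5] at h3
    simp only [Function.comp]
    rw [h3, ← ofReal_re (∫ w : V, Real.exp (-c⁻¹ * ‖w‖ ^ 2) * ρ w), ← integral_complex_ofReal]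
    congr 2
    ext w
    push_cast
    rfl
  refine ⟨hρc.aestronglyMeasurable, ?_⟩
  rw [hasFiniteIntegral_iff_ofReal (ae_of_all _ hρ0)]
  set τ : ℕ → ℝ := fun k => (k : ℝ) + 1 with hτ
  have hτ0 : ∀ k, 0 < τ k := fun k => by positivity
  have hτl : Tendsto τ atTop atTop :=
    tendsto_atTop_add_const_right _ _ tendsto_natCast_atTop_atTop
  have hpt : ∀ w, Tendsto (fun k => ENNReal.ofReal (Real.exp (-(τ k)⁻¹ * ‖w‖ ^ 2) * ρ w)) atTop
      (𝓝 (ENNReal.ofReal (ρ w))) := by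
    intro w
    refine (ENNReal.continuous_ofReal.tendsto _).comp ?_
    have h1 : Tendsto (fun k => -(τ k)⁻¹ * ‖w‖ ^ 2) atTop (𝓝 0) := by
      simpa using (tendsto_inv_atTop_zero.comp hτl).neg.mul_const (‖w‖ ^ 2)
    simpa using ((Real.continuous_exp.tendsto 0).comp h1).mul_const (ρ w)
  have hle : ∫⁻ w, ENNReal.ofReal (ρ w) ≤ liminf (fun k =>
      ∫⁻ w, ENNReal.ofReal (Real.exp (-(τ k)⁻¹ * ‖w‖ ^ 2) * ρ w)) atTop := by
    calc ∫⁻ w, ENNReal.ofReal (ρ w) = ∫⁻ w, liminf (fun k =>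
        ENNReal.ofReal (Real.exp (-(τ k)⁻¹ * ‖w‖ ^ 2) * ρ w)) atTop := by
          simp_rw [(hpt _).liminf_eq]
      _ ≤ _ := lintegral_liminf_le fun k => by fun_prop
  have hlim2 : Tendsto (fun k =>
      ∫⁻ w, ENNReal.ofReal (Real.exp (-(τ k)⁻¹ * ‖w‖ ^ 2) * ρ w)) atTop
      (𝓝 (ENNReal.ofReal (f 0).re)) := by
    refine ((ENNReal.continuous_ofReal.tendsto _).comp (hlim.comp hτl)).congr fun k => ?_
    exact ofReal_integral_eq_lintegral_ofReal (hint _ (hτ0 k))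
      (ae_of_all _ fun w => mul_nonneg (Real.exp_pos _).le (hρ0 w))
  rw [hlim2.liminf_eq] at hle
  exact hle.trans_lt ENNReal.ofReal_lt_top

/-- A continuous integrable function with nonnegative Fourier transform is the characteristic
function of a finite measure. -/
theorem exists_measure_charFun_eq_of_fourier_nonneg {f : V → ℂ} (hc : Continuous f)
    (hf : Integrable f) {ρ : V → ℝ} (hρf : ∀ p, 𝓕 f p = ρ p) (hρ0 : ∀ p, 0 ≤ ρ p) :
    ∃ μ : Measure V, IsFiniteMeasure μ ∧ ∀ t, charFun μ ((2 * Real.pi) • t) = f t := by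
  have hρi := integrable_of_fourier_eq_nonneg hc hf hρf hρ0
  have hFi : Integrable (𝓕 f) := by
    have : 𝓕 f = fun p => (ρ p : ℂ) := funext hρf
    rw [this]
    exact hρi.ofReal
  refine ⟨volume.withDensity fun p => ENNReal.ofReal (ρ p),
    isFiniteMeasure_withDensity_ofReal hρi.2, fun t => ?_⟩
  rw [charFun_apply, integral_withDensity_eq_integral_toReal_smul₀
    hρi.aemeasurable.ennreal_ofReal (ae_of_all _ fun _ => ENNReal.ofReal_lt_top)]
  rw [← congrFun (hc.fourierInv_fourier_eq hf hFi) t, Real.fourierInv_eq']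
  congr 1
  ext p
  rw [ENNReal.toReal_ofReal (hρ0 p), hρf, inner_smul_right, Complex.real_smul, smul_eq_mul,
    mul_comm]

/-- A limit of characteristic functions of probability measures which is continuous at `0` is a
characteristic function. -/
theorem exists_probabilityMeasure_charFun_eq {μ : ℕ → Measure V}
    [hμ : ∀ k, IsProbabilityMeasure (μ k)] {φ : V → ℂ} (hφ : ContinuousAt φ 0)
    (h : ∀ t, Tendsto (fun k => charFun (μ k) t) atTop (𝓝 (φ t))) :
    ∃ ν : Measure V, IsProbabilityMeasure ν ∧ ∀ t, charFun ν t = φ t := by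
  have htight := isTightMeasureSet_of_tendsto_charFun hφ h
  set P : ℕ → ProbabilityMeasure V := fun k => ⟨μ k, hμ k⟩ with hP
  have hcomp : IsCompact (closure (Set.range P)) := by
    refine isCompact_closure_of_isTightMeasureSet ?_
    convert! htight using 1
    ext m
    constructor
    · rintro ⟨_, ⟨k, rfl⟩, rfl⟩
      exact ⟨k, rfl⟩
    · rintro ⟨k, rfl⟩
      exact ⟨P k, ⟨k, rfl⟩, rfl⟩
  -- By Prokhorov's theorem the measures are relatively compact. A limit along an ultrafilter
  -- suffices, because the characteristic functions converge anyway.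
  obtain ⟨ν, -, hν : Tendsto _ _ _⟩ := hcomp.ultrafilter_le_nhds ((hyperfilter ℕ).map P)
    (.trans (by simp) (monotone_principal subset_closure))
  refine ⟨ν, inferInstance, fun t => ?_⟩
  have h1 : Tendsto (fun k => charFun (μ k) t) (hyperfilter ℕ) (𝓝 (φ t)) :=
    (h t).mono_left (Nat.hyperfilter_le_atTop)
  have h2 : Tendsto (fun k => charFun (μ k) t) (hyperfilter ℕ) (𝓝 (charFun (ν : Measure V) t)) := by
    rw [charFun_eq_integral_innerProbChar]
    simp_rw [charFun_eq_integral_innerProbChar]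
    have h3 := (ProbabilityMeasure.tendsto_iff_forall_integral_rclike_tendsto ℂ).1 hν
      (BoundedContinuousFunction.innerProbChar t)
    exact h3
  exact tendsto_nhds_unique h2 h1

variable {H : Type*} [NormedAddCommGroup H] [InnerProductSpace ℂ H] [CompleteSpace H]

/-- The Fourier transform of a Gaussian times a matrix element of a unitary representation is
nonnegative. -/
theorem exists_fourier_gaussian_mul_inner_eq {U : V → unitary (H →L[ℂ] H)}
    (hadd : ∀ a b, U (a + b) = U a * U b)
    (hcont : ∀ x : H, Continuous fun a => (U a : H →L[ℂ] H) x) (x : H) {β : ℝ} (hβ : 0 < β)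
    (p : V) : ∃ r : ℝ, 0 ≤ r ∧
      𝓕 (fun a => ((Real.exp (-(β / 2) * ‖a‖ ^ 2) : ℝ) : ℂ) * ⟪x, (U a : H →L[ℂ] H) x⟫_ℂ) p = r := by
  set g : V → ℝ := fun a => Real.exp (-β * ‖a‖ ^ 2) with hg
  set e : V → ℂ := fun a => cexp (((-2 * Real.pi * ⟪a, p⟫_ℝ : ℝ) : ℂ) * I) with he
  have he1 : ∀ a, ‖e a‖ = 1 := fun a => norm_exp_ofReal_mul_I _
  have hec : Continuous e := by fun_prop
  have hgc : Continuous g := by fun_prop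
  set F : V → H := fun a => ((g a : ℂ) * e a) • (U a : H →L[ℂ] H) x with hF
  have hFc : Continuous F := by have := hcont x; fun_prop
  have hFi : Integrable F := by
    refine ((integrable_exp_neg_mul_sq_norm (V := V) hβ).mul_const ‖x‖).mono'
      hFc.aestronglyMeasurable (ae_of_all _ fun a => ?_)
    rw [hF, norm_smul, norm_mul, he1, norm_unitary_apply, Complex.norm_real,
      Real.norm_of_nonneg (Real.exp_pos _).le, mul_one]
  set φ : V → ℂ := fun a => ⟪x, (U a : H →L[ℂ] H) x⟫_ℂ with hφ
  have hφc : Continuous φ := by have := hcont x; fun_prop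
  have hφb : ∀ a, ‖φ a‖ ≤ ‖x‖ * ‖x‖ := fun a => by
    refine (norm_inner_le_norm _ _).trans ?_
    rw [norm_unitary_apply]
  have hFF : ∀ a s, ⟪F a, F (a + s)⟫_ℂ = ((g a * g (a + s) : ℝ) : ℂ) * (e s * φ s) := by
    intro a s
    have h1 : e (a + s) = e a * e s := by
      simp only [he, ← Complex.exp_add, inner_add_left]
      congr 1
      push_cast
      ring
    have h2 : (starRingEnd ℂ) (e a) * e a = 1 := by
      rw [← Complex.normSq_eq_conj_mul_self, Complex.normSq_eq_norm_sq, he1]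
      simp
    simp only [hF]
    rw [inner_smul_left, inner_smul_right, inner_unitary_apply hadd, h1, map_mul, conj_ofReal]
    push_cast
    linear_combination ((g a : ℂ) * g (a + s) * e s * φ s) * h2
  have hK : ∀ s, ∫ a, ((g a * g (a + s) : ℝ) : ℂ) =
      ((Real.exp (-(β / 2) * ‖s‖ ^ 2) * ∫ a : V, Real.exp (-(2 * β) * ‖a‖ ^ 2) : ℝ) : ℂ) := by
    intro s
    rw [integral_complex_ofReal]
    congr 1
    -- After the shift by `-s / 2` the parallelogram law separates the product of Gaussians: `‖a -
    -- s/2‖² + ‖a + s/2‖² = 2 ‖a‖² + ‖s‖² / 2`.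
    rw [← integral_const_mul, ← integral_add_right_eq_self _ (-((1 / 2 : ℝ) • s))]
    congr 1
    ext a
    simp only [hg, ← Real.exp_add]
    congr 1
    have e1 : a + -((1 / 2 : ℝ) • s) + s = a + (1 / 2 : ℝ) • s := by module
    rw [e1, ← sub_eq_add_neg, norm_sub_sq_real, norm_add_sq_real, norm_smul]
    norm_num
    ring
  have hprod : Integrable (Function.uncurry fun a s =>
      ((g a * g (a + s) : ℝ) : ℂ) * (e s * φ s)) (volume.prod volume) := by
    -- `‖s‖² ≤ 2 ‖a + s‖² + 2 ‖a‖²` gives `‖a‖² + ‖a + s‖² ≥ (‖a‖² + ‖s‖²) / 3`.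
    have h3 := integrable_exp_neg_mul_sq_norm (V := V) (β := β / 3) (by positivity)
    refine ((h3.mul_prod h3).mul_const (‖x‖ * ‖x‖)).mono' ?_ (ae_of_all _ fun q => ?_)
    · exact Continuous.aestronglyMeasurable (by fun_prop)
    · obtain ⟨a, s⟩ := q
      simp only [Function.uncurry, norm_mul, he1, one_mul, Complex.norm_real]
      rw [Real.norm_of_nonneg (Real.exp_pos _).le, Real.norm_of_nonneg (Real.exp_pos _).le]
      refine mul_le_mul ?_ (hφb s) (norm_nonneg _) (by positivity)
      simp only [← Real.exp_add]
      refine Real.exp_le_exp.2 ?_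
      have h4 : ‖s‖ ≤ ‖a + s‖ + ‖a‖ := by
        simpa using norm_sub_le (a + s) a
      have h5 : ‖s‖ ^ 2 ≤ (‖a + s‖ + ‖a‖) ^ 2 := pow_le_pow_left₀ (norm_nonneg _) h4 2
      nlinarith [sq_nonneg (‖a + s‖ - ‖a‖), sq_nonneg ‖a + s‖]
  set K : ℝ := ∫ a : V, Real.exp (-(2 * β) * ‖a‖ ^ 2) with hKdef
  have hK0 : 0 < K := by
    rw [hKdef, GaussianFourier.integral_rexp_neg_mul_sq_norm (by positivity)]
    positivity
  -- The transform is nonnegative because, up to the positive constant `K`, it is the squared norm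
  -- of a smeared vector.
  have hmain : ⟪∫ a, F a, ∫ a, F a⟫_ℂ = K * 𝓕 (fun a =>
      ((Real.exp (-(β / 2) * ‖a‖ ^ 2) : ℝ) : ℂ) * φ a) p := by
    calc ⟪∫ a, F a, ∫ a, F a⟫_ℂ = ∫ a, ⟪F a, ∫ b, F b⟫_ℂ := by
          rw [← inner_conj_symm, ← integral_inner hFi, ← integral_conj]
          simp_rw [inner_conj_symm]
      _ = ∫ a, ∫ s, ((g a * g (a + s) : ℝ) : ℂ) * (e s * φ s) := by
          congr 1
          ext a
          rw [← integral_inner hFi, ← integral_add_left_eq_self _ a]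
          simp_rw [hFF]
      _ = ∫ s, ∫ a, ((g a * g (a + s) : ℝ) : ℂ) * (e s * φ s) := integral_integral_swap hprod
      _ = ∫ s, (K : ℂ) * (e s * (((Real.exp (-(β / 2) * ‖s‖ ^ 2) : ℝ) : ℂ) * φ s)) := by
          congr 1
          ext s
          rw [integral_mul_const, hK]
          push_cast
          ring
      _ = _ := by
          rw [integral_const_mul, Real.fourier_eq']
          simp_rw [smul_eq_mul, he]
  refine ⟨‖∫ a, F a‖ ^ 2 / K, by positivity, ?_⟩
  rw [inner_self_eq_norm_sq_to_K] at hmain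
  rw [ofReal_div, eq_div_iff (by exact_mod_cast hK0.ne'), mul_comm, ← hmain]
  push_cast
  rfl

/-- **Bochner's theorem** for the matrix elements of a unitary representation. -/
theorem exists_spectralMeasure {U : V → unitary (H →L[ℂ] H)}
    (hadd : ∀ a b, U (a + b) = U a * U b)
    (hcont : ∀ x : H, Continuous fun a => (U a : H →L[ℂ] H) x) (x : H) :
    ∃ ν : Measure V, IsFiniteMeasure ν ∧ ∀ a, charFun ν a = ⟪x, (U a : H →L[ℂ] H) x⟫_ℂ := by
  have hU0 : U 0 = 1 := by
    have := hadd 0 0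
    rw [add_zero] at this
    exact (mul_eq_left.1 this.symm)
  rcases eq_or_ne x 0 with rfl | hx
  · exact ⟨0, inferInstance, fun a => by simp⟩
  set φ : V → ℂ := fun a => ⟪x, (U a : H →L[ℂ] H) x⟫_ℂ with hφ
  have hφc : Continuous φ := by have := hcont x; fun_prop
  have hφ0 : φ 0 = (‖x‖ ^ 2 : ℝ) := by
    simp only [hφ, hU0]
    push_cast
    exact inner_self_eq_norm_sq_to_K x
  have hφb : ∀ a, ‖φ a‖ ≤ ‖x‖ * ‖x‖ := fun a => by
    refine (norm_inner_le_norm _ _).trans ?_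
    rw [norm_unitary_apply]
  set τ : ℕ → ℝ := fun k => 1 / ((k : ℝ) + 1) with hτ
  have hτ0 : ∀ k, 0 < τ k := fun k => by positivity
  have hpi : 0 < 2 * Real.pi := by positivity
  -- The Gaussian makes the matrix element integrable and tends to `1` as `k → ∞`; the factor `2 π`
  -- reconciles the normalizations of `𝓕` and `charFun`.
  set f : ℕ → V → ℂ := fun k a => ((Real.exp (-(τ k / 2) * ‖a‖ ^ 2) : ℝ) : ℂ) *
    φ ((2 * Real.pi) • a) with hf
  have hex : ∀ k, ∃ μ : Measure V, IsFiniteMeasure μ ∧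
      ∀ t, charFun μ ((2 * Real.pi) • t) = f k t := by
    intro k
    choose ρ hρ0 hρ using exists_fourier_gaussian_mul_inner_eq
      (U := fun a => U ((2 * Real.pi) • a)) (fun a b => by rw [smul_add, hadd])
      (fun x => (hcont x).comp (continuous_const_smul _)) x (hτ0 k)
    refine exists_measure_charFun_eq_of_fourier_nonneg (by fun_prop) ?_ hρ hρ0
    refine ((integrable_exp_neg_mul_sq_norm (V := V) (half_pos (hτ0 k))).mul_const
      (‖x‖ * ‖x‖)).mono' (Continuous.aestronglyMeasurable (by fun_prop)) (ae_of_all _ fun a => ?_)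
    rw [norm_mul, Complex.norm_real, Real.norm_of_nonneg (Real.exp_pos _).le]
    gcongr
    exact hφb _
  choose μ hμf hμ using hex
  have hμ' : ∀ k t, charFun (μ k) t = f k ((2 * Real.pi)⁻¹ • t) := fun k t => by
    rw [← hμ k, smul_smul, mul_inv_cancel₀ hpi.ne', one_smul]
  have hxn : (0 : ℝ) < ‖x‖ ^ 2 := by have := norm_pos_iff.2 hx; positivity
  have hmass : ∀ k, (μ k).real Set.univ = ‖x‖ ^ 2 := fun k => by
    have h1 := hμ' k 0
    rw [charFun_zero, smul_zero] at h1
    simp only [hf, smul_zero, hφ0] at h1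
    norm_num at h1
    exact_mod_cast h1
  have hlim : ∀ t, Tendsto (fun k => charFun (μ k) t) atTop (𝓝 (φ t)) := by
    intro t
    simp_rw [hμ', hf, smul_smul, mul_inv_cancel₀ hpi.ne', one_smul]
    have h1 : Tendsto (fun k => -(τ k / 2) * ‖(2 * Real.pi)⁻¹ • t‖ ^ 2) atTop (𝓝 0) := by
      have h2 : Tendsto τ atTop (𝓝 0) := tendsto_one_div_add_atTop_nhds_zero_nat
      simpa using (h2.div_const 2).neg.mul_const (‖(2 * Real.pi)⁻¹ • t‖ ^ 2)
    have h3 := ((continuous_ofReal.tendsto _).comp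
      ((Real.continuous_exp.tendsto 0).comp h1)).mul_const (φ t)
    simpa [Function.comp_def] using h3
  set c : NNReal := ⟨(‖x‖ ^ 2)⁻¹, by positivity⟩ with hc
  have hprob : ∀ k, IsProbabilityMeasure (c • μ k) := fun k => by
    constructor
    have h1 := hmass k
    rw [Measure.smul_apply, ← ENNReal.toReal_eq_one_iff]
    rw [ENNReal.smul_def, smul_eq_mul, ENNReal.toReal_mul]
    change _ * (μ k).real Set.univ = 1
    rw [h1]
    exact inv_mul_cancel₀ hxn.ne'
  have hch : ∀ (m : Measure V) (c : NNReal) t, charFun (c • m) t = (c : ℝ) * charFun m t := by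
    intro m c t
    rw [charFun_apply, charFun_apply, integral_smul_nnreal_measure, NNReal.smul_def,
      Complex.real_smul]
  obtain ⟨ν, hν, hνt⟩ := exists_probabilityMeasure_charFun_eq (μ := fun k => c • μ k)
    (φ := fun t => (c : ℝ) * φ t) (by fun_prop) fun t => by
      simp_rw [hch]
      exact (hlim t).const_mul _
  obtain ⟨d, hd⟩ : ∃ d : NNReal, (d : ℝ) = ‖x‖ ^ 2 := ⟨⟨‖x‖ ^ 2, by positivity⟩, rfl⟩
  refine ⟨d • ν, inferInstance, fun t => ?_⟩
  rw [hch, hνt, ← mul_assoc, ← ofReal_mul, hd]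
  change (((‖x‖ ^ 2 * (‖x‖ ^ 2)⁻¹ : ℝ)) : ℂ) * φ t = φ t
  rw [mul_inv_cancel₀ hxn.ne', ofReal_one, one_mul]

end Bochner

/-! ### Characters, the Lorentzian Fourier transform and density of trigonometric polynomials -/

section MomentumSpace

open MeasureTheory Filter Topology
open scoped FourierTransform

variable {n : ℕ}

/-- The space reflection `(x⁰, 𝐱) ↦ (x⁰, -𝐱)`, which relates the Lorentzian product to the
Euclidean one. -/
noncomputable def spaceReflection (n : ℕ) : Spacetime n →ₗ[ℝ] Spacetime n where
  toFun p := WithLp.toLp 2 (Fin.cons (p 0) fun i => -p i.succ)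
  map_add' p q := by
    ext i
    refine Fin.cases ?_ (fun i => ?_) i <;> simp [add_comm]
  map_smul' c p := by
    ext i
    refine Fin.cases ?_ (fun i => ?_) i <;> simp

@[simp]
theorem spaceReflection_spaceReflection (p : Spacetime n) :
    spaceReflection n (spaceReflection n p) = p := by
  ext i
  refine Fin.cases ?_ (fun i => ?_) i <;> simp [spaceReflection]

theorem minkowski_eq_inner (p a : Spacetime n) : minkowski p a = ⟪spaceReflection n p, a⟫_ℝ := by
  rw [PiLp.inner_apply, Fin.sum_univ_succ]
  simp [minkowski, spaceReflection, mul_comm, sub_eq_add_neg]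

theorem continuous_spaceReflection : Continuous (spaceReflection n) :=
  (spaceReflection n).continuous_of_finiteDimensional

/-- The space reflection as a continuous linear equivalence. -/
noncomputable def spaceReflectionEquiv (n : ℕ) : Spacetime n ≃L[ℝ] Spacetime n :=
  (LinearEquiv.ofInvolutive (spaceReflection n)
    spaceReflection_spaceReflection).toContinuousLinearEquiv

@[simp]
theorem spaceReflectionEquiv_apply (p : Spacetime n) :
    spaceReflectionEquiv n p = spaceReflection n p := rfl

/-- The character `exp (i p · a)`. -/
noncomputable def character (a p : Spacetime n) : ℂ :=
  Complex.exp (Complex.I * (minkowski p a : ℂ))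

theorem character_eq (a p : Spacetime n) :
    character a p = Complex.exp (((⟪spaceReflection n p, a⟫_ℝ : ℝ) : ℂ) * Complex.I) := by
  rw [character, minkowski_eq_inner, mul_comm]

theorem continuous_character_uncurry :
    Continuous fun q : Spacetime n × Spacetime n => character q.1 q.2 := by
  simp_rw [character_eq]
  have := continuous_spaceReflection (n := n)
  fun_prop

theorem continuous_character (a : Spacetime n) : Continuous (character a) :=
  continuous_character_uncurry.comp (Continuous.prodMk_right a)

@[simp]
theorem norm_character (a p : Spacetime n) : ‖character a p‖ = 1 := by
  rw [character_eq, Complex.norm_exp_ofReal_mul_I]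

theorem character_add (a b p : Spacetime n) :
    character (a + b) p = character a p * character b p := by
  simp only [character_eq, ← Complex.exp_add, inner_add_right]
  congr 1
  push_cast
  ring

@[simp]
theorem character_zero (p : Spacetime n) : character 0 p = 1 := by
  simp [character_eq]

theorem conj_character (a p : Spacetime n) :
    (starRingEnd ℂ) (character a p) = character (-a) p := by
  rw [character_eq, character_eq, ← Complex.exp_conj]
  simp

/-- The Fourier transform with respect to the Lorentzian product. -/
noncomputable def lorentzFourier (f : 𝓢(Spacetime n, ℂ)) (p : Spacetime n) : ℂ :=
  ∫ a, f a * character a p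

theorem lorentzFourier_eq (f : 𝓢(Spacetime n, ℂ)) (p : Spacetime n) :
    lorentzFourier f p = 𝓕 f (-(2 * Real.pi)⁻¹ • spaceReflection n p) := by
  rw [SchwartzMap.fourier_coe, Real.fourier_eq', lorentzFourier]
  congr 1
  ext a
  rw [smul_eq_mul, mul_comm, character_eq, inner_smul_right, real_inner_comm]
  congr 3
  have : (2 * Real.pi) ≠ 0 := by positivity
  field_simp

theorem continuous_lorentzFourier (f : 𝓢(Spacetime n, ℂ)) : Continuous (lorentzFourier f) := by
  have h1 : lorentzFourier f = fun p => 𝓕 f (-(2 * Real.pi)⁻¹ • spaceReflection n p) :=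
    funext (lorentzFourier_eq f)
  rw [h1]
  have := continuous_spaceReflection (n := n)
  exact (𝓕 f).continuous.comp (by fun_prop)

theorem norm_lorentzFourier_le (f : 𝓢(Spacetime n, ℂ)) (p : Spacetime n) :
    ‖lorentzFourier f p‖ ≤ ∫ a, ‖f a‖ := by
  refine (norm_integral_le_integral_norm _).trans_eq ?_
  simp

/-- Smooth functions of compact support are Fourier transforms of Schwartz functions. -/
theorem exists_lorentzFourier_eq {φ : Spacetime n → ℂ} (hs : HasCompactSupport φ)
    (hd : ContDiff ℝ (⊤ : ℕ∞) φ) :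
    ∃ f : 𝓢(Spacetime n, ℂ), lorentzFourier f = φ := by
  have hc : (-(2 * Real.pi) : ℝ) ≠ 0 := by
    have := Real.pi_pos
    exact neg_ne_zero.2 (by positivity)
  set e : Spacetime n ≃L[ℝ] Spacetime n :=
    (spaceReflectionEquiv n).trans (ContinuousLinearEquiv.smulLeft (Units.mk0 _ hc)) with he
  set g : 𝓢(Spacetime n, ℂ) :=
    SchwartzMap.compCLMOfContinuousLinearEquiv ℂ e (hs.toSchwartzMap hd) with hg
  refine ⟨𝓕⁻ g, funext fun p => ?_⟩
  rw [lorentzFourier_eq, FourierTransform.fourier_fourierInv_eq, hg,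
    SchwartzMap.compCLMOfContinuousLinearEquiv_apply]
  simp only [Function.comp, HasCompactSupport.toSchwartzMap_toFun]
  change φ (e _) = φ p
  congr 1
  simp only [he, ContinuousLinearEquiv.trans_apply, spaceReflectionEquiv_apply, map_smul,
    spaceReflection_spaceReflection]
  change -(2 * Real.pi)⁻¹ • (-(2 * Real.pi)) • p = p
  rw [smul_smul]
  have : (2 * Real.pi) ≠ 0 := by positivity
  field_simp
  simp

variable {μ : Measure (Spacetime n)} [IsFiniteMeasure μ]

theorem memLp_character (a : Spacetime n) : MemLp (character a) 2 μ :=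
  MemLp.of_bound (continuous_character a).aestronglyMeasurable 1 (ae_of_all _ fun p => by simp)

/-- Trigonometric polynomials. -/
noncomputable def trigPoly (n : ℕ) : (Spacetime n →₀ ℂ) →ₗ[ℂ] (Spacetime n → ℂ) :=
  Finsupp.linearCombination ℂ character

theorem trigPoly_apply (c : Spacetime n →₀ ℂ) (p : Spacetime n) :
    trigPoly n c p = c.sum fun a z => z * character a p := by
  simp [trigPoly, Finsupp.linearCombination_apply, Finsupp.sum, Finset.sum_apply]

theorem memLp_trigPoly (c : Spacetime n →₀ ℂ) : MemLp (trigPoly n c) 2 μ := by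
  rw [trigPoly, Finsupp.linearCombination_apply, Finsupp.sum]
  exact memLp_finsetSum' _ fun a _ => (memLp_character a).const_smul _

/-- Trigonometric polynomials as elements of `L²`. -/
noncomputable def trigLp (μ : Measure (Spacetime n)) [IsFiniteMeasure μ] :
    (Spacetime n →₀ ℂ) →ₗ[ℂ] Lp ℂ 2 μ where
  toFun c := (memLp_trigPoly c).toLp (trigPoly n c)
  map_add' c d := by
    rw [← MemLp.toLp_add]
    congr 1
    exact map_add _ c d
  map_smul' z c := by
    rw [RingHom.id_apply, ← MemLp.toLp_const_smul]
    congr 1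
    exact map_smul _ z c

theorem trigLp_apply (c : Spacetime n →₀ ℂ) :
    trigLp μ c = (memLp_trigPoly c).toLp (trigPoly n c) := rfl

/-- Fubini's theorem for the Fourier transform. -/
theorem integral_lorentzFourier_mul {k : Spacetime n → ℂ} (hk : Integrable k μ)
    (f : 𝓢(Spacetime n, ℂ)) :
    ∫ p, lorentzFourier f p * k p ∂μ = ∫ a, f a * ∫ p, character a p * k p ∂μ := by
  have hint : Integrable (Function.uncurry fun (p a : Spacetime n) => f a * character a p * k p)
      (μ.prod volume) := by
    have h1 : Integrable (fun q : Spacetime n × Spacetime n => k q.1 * f q.2) (μ.prod volume) :=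
      hk.mul_prod f.integrable
    have h2 := h1.bdd_mul (c := 1) (f := fun q : Spacetime n × Spacetime n => character q.2 q.1)
      (continuous_character_uncurry.comp continuous_swap).aestronglyMeasurable
      (ae_of_all _ fun q => by simp)
    refine h2.congr (ae_of_all _ fun q => ?_)
    simp only [Function.uncurry]
    ring
  calc ∫ p, lorentzFourier f p * k p ∂μ = ∫ p, (∫ a, f a * character a p * k p) ∂μ := by
        simp_rw [lorentzFourier, integral_mul_const]
    _ = ∫ a, ∫ p, f a * character a p * k p ∂μ := integral_integral_swap hint
    _ = _ := by simp_rw [mul_assoc, integral_const_mul]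

/-- If `k` is orthogonal to all characters, Fubini's theorem makes it orthogonal to all Fourier
transforms of Schwartz functions, in particular to all test functions, so `k = 0` almost everywhere.
-/
theorem denseRange_trigLp : DenseRange (trigLp μ) := by
  have h1 : (LinearMap.range (trigLp μ))ᗮ = ⊥ := by
    rw [Submodule.eq_bot_iff]
    intro k hk
    have hk1 : Integrable k μ := (Lp.memLp k).integrable (by norm_num)
    have h2 : ∀ a, ∫ p, character a p * k p ∂μ = 0 := by
      intro a
      have h3 := (Submodule.mem_orthogonal _ _).1 hk _
        (LinearMap.mem_range_self (trigLp μ) (Finsupp.single (-a) 1))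
      rw [L2.inner_def] at h3
      rw [← h3]
      refine integral_congr_ae ?_
      filter_upwards [(memLp_trigPoly (μ := μ) (Finsupp.single (-a) 1)).coeFn_toLp] with p hp
      rw [trigLp_apply, hp, trigPoly_apply, RCLike.inner_apply, Finsupp.sum_single_index (by simp),
        one_mul, conj_character, neg_neg, mul_comm]
    have h4 : ∀ᵐ p ∂μ, k p = 0 := by
      refine ae_eq_zero_of_integral_contDiff_smul_eq_zero hk1.locallyIntegrable
        fun g hg hgs => ?_
      obtain ⟨f, hf⟩ := exists_lorentzFourier_eq (φ := fun p => (g p : ℂ))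
        (hgs.comp_left Complex.ofReal_zero) (Complex.ofRealCLM.contDiff.comp hg)
      have h5 := integral_lorentzFourier_mul hk1 f
      simp_rw [h2, mul_zero, integral_zero, hf] at h5
      simpa [Complex.real_smul] using h5
    refine Lp.ext ?_
    filter_upwards [h4, Lp.coeFn_zero ℂ 2 μ] with p h5 h6
    rw [h5, h6, Pi.zero_apply]
  exact (Submodule.dense_iff_topologicalClosure_eq_top).2
    ((Submodule.topologicalClosure_eq_top_iff).2 h1)

/-- Trigonometric polynomials approximate square integrable functions. -/
theorem exists_tendsto_trigPoly {g : Spacetime n → ℂ} (hg : MemLp g 2 μ) :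
    ∃ c : ℕ → Spacetime n →₀ ℂ,
      Tendsto (fun k => eLpNorm (trigPoly n (c k) - g) 2 μ) atTop (𝓝 0) := by
  obtain ⟨y, hy, hlim⟩ := mem_closure_iff_seq_limit.1 (denseRange_trigLp (μ := μ) (hg.toLp g))
  choose c hc using hy
  refine ⟨c, ?_⟩
  have h1 : Tendsto (fun k => (memLp_trigPoly (c k)).toLp (trigPoly n (c k))) atTop
      (𝓝 (hg.toLp g)) := by
    simp_rw [← trigLp_apply, hc]
    exact hlim
  exact (Lp.tendsto_Lp_iff_tendsto_eLpNorm'' _ _ _ _).1 h1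

end MomentumSpace

/-! ### Functions of the momentum applied to a vector -/

section SpectralCalculus

open MeasureTheory Filter Topology

variable {n : ℕ} {H : Type*} [NormedAddCommGroup H] [InnerProductSpace ℂ H] [CompleteSpace H]

/-- A strongly continuous unitary representation of the translations. -/
structure IsTranslationRep (U : Spacetime n → unitary (H →L[ℂ] H)) : Prop where
  add : ∀ a b, U (a + b) = U a * U b
  continuous : ∀ ψ : H, Continuous fun a => (U a : H →L[ℂ] H) ψ

/-- The measure `ν` on momentum space is the spectral measure of the vector `x`. -/
def IsSpectralMeasure (U : Spacetime n → unitary (H →L[ℂ] H)) (ν : Measure (Spacetime n)) (x : H) :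
    Prop :=
  ∀ a, ∫ p, character a p ∂ν = ⟪x, (U a : H →L[ℂ] H) x⟫_ℂ

/-- The measure `μ` dominates the spectral measure of the vector `x`. -/
def IsDominated (U : Spacetime n → unitary (H →L[ℂ] H)) (μ : Measure (Spacetime n)) (x : H) :
    Prop :=
  ∃ ν ≤ μ, IsSpectralMeasure U ν x

/-- The vectors `Σ c_a U(a) x`. -/
noncomputable def trigVec (U : Spacetime n → unitary (H →L[ℂ] H)) (x : H) :
    (Spacetime n →₀ ℂ) →ₗ[ℂ] H :=
  Finsupp.linearCombination ℂ fun a => (U a : H →L[ℂ] H) x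

/-- The continuous linear map `L²(μ) → H` which maps the character of `a` to `U(a) x`. -/
noncomputable def spectralMap (U : Spacetime n → unitary (H →L[ℂ] H)) (μ : Measure (Spacetime n))
    [IsFiniteMeasure μ] (x : H) : Lp ℂ 2 μ →L[ℂ] H :=
  (trigVec U x).extendOfNorm (trigLp μ)

open Classical in
/-- The vector `g(P) x` for a square integrable function `g` of the momentum. -/
noncomputable def spectralApply (U : Spacetime n → unitary (H →L[ℂ] H))
    (μ : Measure (Spacetime n)) [IsFiniteMeasure μ] (x : H) (g : Spacetime n → ℂ) : H :=
  if h : MemLp g 2 μ then spectralMap U μ x (h.toLp g) else 0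

variable {U : Spacetime n → unitary (H →L[ℂ] H)}

theorem IsTranslationRep.zero (hU : IsTranslationRep U) : U 0 = 1 := by
  have := hU.add 0 0
  rw [add_zero] at this
  exact mul_eq_left.1 this.symm

theorem IsTranslationRep.exists_isSpectralMeasure (hU : IsTranslationRep U) (x : H) :
    ∃ ν : Measure (Spacetime n), IsFiniteMeasure ν ∧ IsSpectralMeasure U ν x := by
  obtain ⟨ν, hν, h⟩ := exists_spectralMeasure hU.add hU.continuous x
  refine ⟨ν.map (spaceReflection n), inferInstance, fun a => ?_⟩
  rw [integral_map continuous_spaceReflection.aemeasurable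
    (continuous_character a).aestronglyMeasurable, ← h, charFun_apply]
  simp_rw [character_eq, spaceReflection_spaceReflection]

/-- The characters in `L²(ν)` and the vectors `U(a) x` have the same Gram matrix. -/
theorem norm_trigVec {ν : Measure (Spacetime n)} [IsFiniteMeasure ν] (hU : IsTranslationRep U)
    {x : H} (hν : IsSpectralMeasure U ν x) (c : Spacetime n →₀ ℂ) :
    ‖trigVec U x c‖ = (eLpNorm (trigPoly n c) 2 ν).toReal := by
  have h1 : ∀ a b, ⟪(memLp_character (μ := ν) a).toLp (character a),
      (memLp_character (μ := ν) b).toLp (character b)⟫_ℂ =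
      ⟪(U a : H →L[ℂ] H) x, (U b : H →L[ℂ] H) x⟫_ℂ := by
    intro a b
    have h2 := inner_unitary_apply hU.add a (b - a) x x
    rw [add_sub_cancel] at h2
    rw [h2, ← hν, L2.inner_def]
    refine integral_congr_ae ?_
    filter_upwards [(memLp_character (μ := ν) a).coeFn_toLp,
      (memLp_character (μ := ν) b).coeFn_toLp] with p ha hb
    rw [ha, hb, RCLike.inner_apply, conj_character, sub_eq_add_neg, character_add]
  have h2 : trigLp ν c = Finsupp.linearCombination ℂ
      (fun a => (memLp_character (μ := ν) a).toLp (character a)) c := by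
    congr 1
    ext a
    simp only [LinearMap.comp_apply, Finsupp.lsingle_apply, Finsupp.linearCombination_single,
      one_smul, trigLp_apply]
    simp [trigPoly]
  rw [← Lp.norm_toLp _ (memLp_trigPoly c), ← trigLp_apply, h2, trigVec,
    @norm_eq_sqrt_re_inner ℂ, @norm_eq_sqrt_re_inner ℂ]
  congr 2
  simp only [Finsupp.linearCombination_apply, Finsupp.sum, sum_inner, inner_sum, inner_smul_left,
    inner_smul_right, h1]

variable {μ : Measure (Spacetime n)} [IsFiniteMeasure μ] {x y : H} {g : Spacetime n → ℂ}

theorem IsDominated.norm_trigVec_le (hU : IsTranslationRep U) (hx : IsDominated U μ x)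
    (c : Spacetime n →₀ ℂ) : ‖trigVec U x c‖ ≤ 1 * ‖trigLp μ c‖ := by
  obtain ⟨ν, hνμ, hν⟩ := hx
  have := isFiniteMeasure_of_le μ hνμ
  rw [norm_trigVec hU hν, one_mul, trigLp_apply, Lp.norm_toLp]
  exact ENNReal.toReal_mono (memLp_trigPoly c).eLpNorm_ne_top (eLpNorm_mono_measure _ hνμ)

theorem spectralApply_of_memLp (hg : MemLp g 2 μ) :
    spectralApply U μ x g = spectralMap U μ x (hg.toLp g) := by
  rw [spectralApply, dif_pos hg]

theorem spectralApply_trigPoly (hU : IsTranslationRep U) (hx : IsDominated U μ x)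
    (c : Spacetime n →₀ ℂ) : spectralApply U μ x (trigPoly n c) = trigVec U x c := by
  rw [spectralApply_of_memLp (memLp_trigPoly c), ← trigLp_apply, spectralMap,
    LinearMap.extendOfNorm_eq denseRange_trigLp ⟨1, hx.norm_trigVec_le hU⟩]

theorem tendsto_spectralApply {ι : Type*} {l : Filter ι} {G : ι → Spacetime n → ℂ}
    (hG : ∀ k, MemLp (G k) 2 μ) (hg : MemLp g 2 μ)
    (h : Tendsto (fun k => eLpNorm (G k - g) 2 μ) l (𝓝 0)) :
    Tendsto (fun k => spectralApply U μ x (G k)) l (𝓝 (spectralApply U μ x g)) := by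
  simp_rw [spectralApply_of_memLp (hG _), spectralApply_of_memLp hg]
  exact ((spectralMap U μ x).continuous.tendsto _).comp
    ((Lp.tendsto_Lp_iff_tendsto_eLpNorm'' _ hG _ hg).2 h)

theorem spectralApply_add {g' : Spacetime n → ℂ} (hg : MemLp g 2 μ) (hg' : MemLp g' 2 μ) :
    spectralApply U μ x (g + g') = spectralApply U μ x g + spectralApply U μ x g' := by
  rw [spectralApply_of_memLp (hg.add hg'), spectralApply_of_memLp hg, spectralApply_of_memLp hg',
    MemLp.toLp_add, map_add]

theorem spectralApply_smul (z : ℂ) (hg : MemLp g 2 μ) :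
    spectralApply U μ x (z • g) = z • spectralApply U μ x g := by
  rw [spectralApply_of_memLp (hg.const_smul z), spectralApply_of_memLp hg,
    MemLp.toLp_const_smul, map_smul]

theorem spectralApply_sub {g' : Spacetime n → ℂ} (hg : MemLp g 2 μ) (hg' : MemLp g' 2 μ) :
    spectralApply U μ x (g - g') = spectralApply U μ x g - spectralApply U μ x g' := by
  rw [spectralApply_of_memLp (hg.sub hg'), spectralApply_of_memLp hg, spectralApply_of_memLp hg',
    MemLp.toLp_sub, map_sub]

/-- One sequence of trigonometric polynomials serves all vectors dominated by `μ`. This is why a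
common dominating measure is used instead of each vector's own spectral measure. -/
theorem exists_tendsto_trigVec (hU : IsTranslationRep U) (hg : MemLp g 2 μ) :
    ∃ c : ℕ → Spacetime n →₀ ℂ,
      Tendsto (fun k => eLpNorm (trigPoly n (c k) - g) 2 μ) atTop (𝓝 0) ∧
      ∀ x, IsDominated U μ x →
        Tendsto (fun k => trigVec U x (c k)) atTop (𝓝 (spectralApply U μ x g)) := by
  obtain ⟨c, hc⟩ := exists_tendsto_trigPoly hg
  refine ⟨c, hc, fun x hx => ?_⟩
  simp_rw [← spectralApply_trigPoly hU hx]
  exact tendsto_spectralApply (fun k => memLp_trigPoly _) hg hc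

theorem trigVec_single (a : Spacetime n) (z : ℂ) :
    trigVec U x (Finsupp.single a z) = z • (U a : H →L[ℂ] H) x := by
  simp [trigVec]

theorem trigPoly_single (a : Spacetime n) (z : ℂ) :
    trigPoly n (Finsupp.single a z) = z • character a := by
  simp [trigPoly]

theorem spectralApply_one (hU : IsTranslationRep U) (hx : IsDominated U μ x) :
    spectralApply U μ x 1 = x := by
  have h := spectralApply_trigPoly hU hx (Finsupp.single 0 1)
  have h1 : character (0 : Spacetime n) = 1 := by
    ext p
    simp
  rwa [trigPoly_single, trigVec_single, one_smul, one_smul, h1, hU.zero] at h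

theorem norm_spectralApply (hU : IsTranslationRep U) {ν : Measure (Spacetime n)} (hνμ : ν ≤ μ)
    (hν : IsSpectralMeasure U ν x) (hg : MemLp g 2 μ) :
    ‖spectralApply U μ x g‖ = (eLpNorm g 2 ν).toReal := by
  have := isFiniteMeasure_of_le μ hνμ
  obtain ⟨c, hc, hcx⟩ := exists_tendsto_trigVec hU hg
  have h1 := (hcx x ⟨ν, hνμ, hν⟩).norm
  simp_rw [norm_trigVec hU hν] at h1
  refine tendsto_nhds_unique h1 ?_
  have hgν : MemLp g 2 ν := hg.mono_measure hνμ
  have h2 : Tendsto (fun k => eLpNorm (trigPoly n (c k) - g) 2 ν) atTop (𝓝 0) :=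
    tendsto_of_tendsto_of_tendsto_of_le_of_le tendsto_const_nhds hc (fun _ => zero_le)
      fun k => eLpNorm_mono_measure _ hνμ
  have h3 := ((Lp.tendsto_Lp_iff_tendsto_eLpNorm'' _ (fun k => memLp_trigPoly (c k)) _ hgν).2 h2).norm
  simpa only [Lp.norm_toLp] using h3

theorem spectralApply_congr {g' : Spacetime n → ℂ} (hU : IsTranslationRep U)
    {ν : Measure (Spacetime n)} (hνμ : ν ≤ μ) (hν : IsSpectralMeasure U ν x) (hg : MemLp g 2 μ)
    (hg' : MemLp g' 2 μ) (h : g =ᵐ[ν] g') : spectralApply U μ x g = spectralApply U μ x g' := by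
  rw [← sub_eq_zero, ← spectralApply_sub hg hg', ← norm_eq_zero,
    norm_spectralApply hU hνμ hν (hg.sub hg')]
  have h1 : g - g' =ᵐ[ν] 0 := by
    filter_upwards [h] with p hp
    simp [hp]
  rw [eLpNorm_congr_ae h1]
  simp

theorem norm_spectralApply_le (hU : IsTranslationRep U) (hx : IsDominated U μ x)
    (hg : MemLp g 2 μ) (hg1 : ∀ p, ‖g p‖ ≤ 1) : ‖spectralApply U μ x g‖ ≤ ‖x‖ := by
  obtain ⟨ν, hνμ, hν⟩ := hx
  have := isFiniteMeasure_of_le μ hνμ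
  nth_rw 2 [← spectralApply_one hU ⟨ν, hνμ, hν⟩]
  have h1 : ∀ ρ : Measure (Spacetime n), IsFiniteMeasure ρ →
      MemLp (1 : Spacetime n → ℂ) 2 ρ := fun ρ _ => memLp_const 1
  rw [norm_spectralApply hU hνμ hν hg, norm_spectralApply hU hνμ hν (h1 μ inferInstance)]
  refine ENNReal.toReal_mono (h1 ν inferInstance).eLpNorm_ne_top (eLpNorm_mono fun p => ?_)
  simpa using hg1 p

theorem spectralApply_sub_vector (hU : IsTranslationRep U) (hx : IsDominated U μ x)
    (hy : IsDominated U μ y) (hxy : IsDominated U μ (x - y)) (hg : MemLp g 2 μ) :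
    spectralApply U μ (x - y) g = spectralApply U μ x g - spectralApply U μ y g := by
  obtain ⟨c, -, hc⟩ := exists_tendsto_trigVec hU hg
  refine tendsto_nhds_unique (hc _ hxy) (((hc _ hx).sub (hc _ hy)).congr fun k => ?_)
  simp [trigVec, Finsupp.linearCombination_apply, Finsupp.sum, smul_sub]

/-- Closed invariant subspaces are invariant under the functional calculus. -/
theorem spectralApply_mem (hU : IsTranslationRep U) (hx : IsDominated U μ x) (hg : MemLp g 2 μ)
    {K : Submodule ℂ H} (hK : IsClosed (K : Set H)) (hKU : ∀ a, (U a : H →L[ℂ] H) x ∈ K) :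
    spectralApply U μ x g ∈ K := by
  obtain ⟨c, -, hc⟩ := exists_tendsto_trigVec hU hg
  refine hK.mem_of_tendsto (hc _ hx) (Eventually.of_forall fun k => ?_)
  rw [trigVec, Finsupp.linearCombination_apply]
  exact Submodule.sum_mem _ fun a _ => K.smul_mem _ (hKU a)

theorem memLp_mul {μ : Measure (Spacetime n)} {G : Spacetime n → ℂ} (hG : AEStronglyMeasurable G μ) {K : ℝ}
    (hGK : ∀ᵐ p ∂μ, ‖G p‖ ≤ K) (hg : MemLp g 2 μ) : MemLp (G * g) 2 μ :=
  hg.of_le_mul (c := K) (hG.mul hg.1) (by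
    filter_upwards [hGK] with p hp
    rw [Pi.mul_apply, norm_mul]
    gcongr)

theorem memLp_character_mul {μ : Measure (Spacetime n)} (a : Spacetime n) (hg : MemLp g 2 μ) : MemLp (character a * g) 2 μ :=
  memLp_mul (K := 1) (continuous_character a).aestronglyMeasurable (ae_of_all _ fun p => by simp) hg

theorem spectralApply_character_mul (hU : IsTranslationRep U) (hx : IsDominated U μ x)
    (a : Spacetime n) (hg : MemLp g 2 μ) :
    spectralApply U μ x (character a * g) = (U a : H →L[ℂ] H) (spectralApply U μ x g) := by
  obtain ⟨c, hc, hcx⟩ := exists_tendsto_trigVec hU hg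
  have h1 : ∀ c, spectralApply U μ x (character a * trigPoly n c) =
      (U a : H →L[ℂ] H) (trigVec U x c) := by
    intro c
    have h2 : character a * trigPoly n c = trigPoly n (c.mapDomain fun b => a + b) := by
      ext p
      rw [Pi.mul_apply, trigPoly_apply, trigPoly_apply,
        Finsupp.sum_mapDomain_index (by simp) (fun _ _ _ => add_mul _ _ _), Finsupp.sum, Finsupp.sum, Finset.mul_sum]
      refine Finset.sum_congr rfl fun b _ => ?_
      rw [character_add]
      ring
    rw [h2, spectralApply_trigPoly hU hx]
    simp only [trigVec]
    rw [Finsupp.linearCombination_mapDomain, Finsupp.linearCombination_apply,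
      Finsupp.linearCombination_apply, Finsupp.sum, Finsupp.sum, map_sum]
    refine Finset.sum_congr rfl fun b _ => ?_
    rw [map_smul, Function.comp, hU.add]
    rfl
  have h3 := (((U a : H →L[ℂ] H).continuous.tendsto _).comp (hcx x hx))
  refine tendsto_nhds_unique ?_ h3
  refine (tendsto_spectralApply (x := x) (U := U)
    (fun k => memLp_character_mul a (memLp_trigPoly (c k)))
    (memLp_character_mul a hg) ?_).congr fun k => h1 (c k)
  refine hc.congr fun k => ?_
  refine eLpNorm_congr_norm_ae (ae_of_all _ fun p => ?_)
  simp only [Pi.sub_apply, Pi.mul_apply, ← mul_sub, norm_mul, norm_character, one_mul]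

theorem memLp_lorentzFourier_mul {μ : Measure (Spacetime n)} (f : 𝓢(Spacetime n, ℂ)) (hg : MemLp g 2 μ) :
    MemLp (lorentzFourier f * g) 2 μ :=
  memLp_mul (continuous_lorentzFourier f).aestronglyMeasurable
    (ae_of_all _ (norm_lorentzFourier_le f)) hg

/-- The operator `∫ f(a) U(a) da` is the function of the momentum given by the Fourier transform
of `f`. -/
theorem integral_smul_spectralApply (hU : IsTranslationRep U) (hx : IsDominated U μ x)
    (hg : MemLp g 2 μ) (f : 𝓢(Spacetime n, ℂ)) :
    ∫ a, f a • (U a : H →L[ℂ] H) (spectralApply U μ x g) =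
      spectralApply U μ x (lorentzFourier f * g) := by
  have hint : Integrable fun a => f a • (U a : H →L[ℂ] H) (spectralApply U μ x g) := by
    refine (f.integrable.norm.mul_const ‖spectralApply U μ x g‖).mono'
      (f.continuous.smul (hU.continuous _)).aestronglyMeasurable (ae_of_all _ fun a => ?_)
    rw [norm_smul, norm_unitary_apply]
  refine ext_inner_left ℂ fun w => ?_
  rw [← integral_inner hint]
  -- The adjoint represents `⟪w, g(P) x⟫` as the integral of `g` against the complex measure with
  -- density `conj k`, which reduces the claim to Fubini's theorem.
  set k := ContinuousLinearMap.adjoint (spectralMap U μ x) w with hk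
  have hdual : ∀ {g : Spacetime n → ℂ}, MemLp g 2 μ →
      ⟪w, spectralApply U μ x g⟫_ℂ = ∫ p, g p * (starRingEnd ℂ) (k p) ∂μ := by
    intro g hg
    rw [spectralApply_of_memLp hg, ← ContinuousLinearMap.adjoint_inner_left, ← hk, L2.inner_def]
    refine integral_congr_ae ?_
    filter_upwards [hg.coeFn_toLp] with p hp
    rw [hp, RCLike.inner_apply]
  have hkg : Integrable (fun p => g p * (starRingEnd ℂ) (k p)) μ :=
    hg.integrable_mul (Lp.memLp k).star
  rw [hdual (memLp_lorentzFourier_mul f hg)]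
  have h1 := integral_lorentzFourier_mul hkg f
  simp_rw [Pi.mul_apply, mul_assoc]
  rw [h1]
  congr 1
  ext a
  rw [inner_smul_right, ← spectralApply_character_mul hU hx a hg,
    hdual (memLp_character_mul a hg)]
  simp_rw [Pi.mul_apply, mul_assoc]

/-- A vector with momentum in a closed set has spectral measure supported there. -/
theorem HasMomentumIn.measure_compl_eq_zero (hU : IsTranslationRep U)
    {ν : Measure (Spacetime n)} [IsFiniteMeasure ν] (hν : IsSpectralMeasure U ν x)
    {C : Set (Spacetime n)} (hC : IsClosed C) (hx : HasMomentumIn U C x) : ν Cᶜ = 0 := by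
  have hd : IsDominated U ν x := ⟨ν, le_rfl, hν⟩
  have h1 : MemLp (1 : Spacetime n → ℂ) 2 ν := memLp_const 1
  -- Near `p ∉ C` a bump function `φ` supported off `C` satisfies `φ(P) x = 0`. The norm of this
  -- vector is that of `φ` in `L²(ν)`, so `ν` vanishes where `φ ≠ 0`.
  refine measure_null_of_locally_null _ fun p hp => ?_
  obtain ⟨φ, hφs, hφc, hφd, -, hφp⟩ :=
    exists_contDiff_tsupport_subset (n := ⊤) (hC.isOpen_compl.mem_nhds hp)
  obtain ⟨f, hf⟩ := exists_lorentzFourier_eq (φ := fun p => (φ p : ℂ))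
    (hφc.comp_left Complex.ofReal_zero) (Complex.ofRealCLM.contDiff.comp hφd)
  have h2 : ∫ a, f a • (U a : H →L[ℂ] H) x = 0 := by
    refine hx f fun q hq => ?_
    change lorentzFourier f q = 0
    rw [hf, Complex.ofReal_eq_zero]
    by_contra h0
    exact hφs (subset_tsupport φ h0) hq
  have h3 := integral_smul_spectralApply hU hd h1 f
  rw [spectralApply_one hU hd, h2, mul_one] at h3
  have h4 := norm_spectralApply hU le_rfl hν (g := lorentzFourier f)
    (by simpa using memLp_lorentzFourier_mul f h1)
  rw [← h3, norm_zero, eq_comm, ENNReal.toReal_eq_zero_iff] at h4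
  have h5 : lorentzFourier f =ᵐ[ν] 0 := by
    rcases h4 with h4 | h4
    · exact (eLpNorm_eq_zero_iff (continuous_lorentzFourier f).aestronglyMeasurable
        (by norm_num)).1 h4
    · exact absurd h4 (MemLp.eLpNorm_ne_top (by simpa using memLp_lorentzFourier_mul f h1))
  refine ⟨{q | φ q ≠ 0}, mem_nhdsWithin_of_mem_nhds
    ((hφd.continuous.continuousAt.ne_iff_eventually_ne continuousAt_const).1 (by simp [hφp])), ?_⟩
  rw [hf] at h5
  refine measure_mono_null (fun q hq => ?_) h5
  simpa using hq

end SpectralCalculus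

/-! ### Multipliers preserving a closed real subspace of `H × H` -/

section Multipliers

open MeasureTheory Filter Topology

variable {n : ℕ} {H : Type*} [NormedAddCommGroup H] [InnerProductSpace ℂ H] [CompleteSpace H]

/-- Dominated convergence with majorant `2 K |g|`. -/
theorem tendsto_eLpNorm_mul_sub {X : Type*} [MeasurableSpace X] {μ : Measure X}
    {F : ℕ → X → ℂ} {G g : X → ℂ} {K : ℝ} (hF : ∀ k, AEStronglyMeasurable (F k) μ)
    (hFK : ∀ k, ∀ᵐ p ∂μ, ‖F k p‖ ≤ K)
    (hlim : ∀ᵐ p ∂μ, Tendsto (fun k => F k p) atTop (𝓝 (G p))) (hg : MemLp g 2 μ) :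
    Tendsto (fun k => eLpNorm (F k * g - G * g) 2 μ) atTop (𝓝 0) := by
  have hG : AEStronglyMeasurable G μ := aestronglyMeasurable_of_tendsto_ae _ hF hlim
  have hGK : ∀ᵐ p ∂μ, ‖G p‖ ≤ K := by
    filter_upwards [hlim, ae_all_iff.2 hFK] with p h1 h2
    exact le_of_tendsto h1.norm (Eventually.of_forall h2)
  have hpow : Tendsto (fun k => ∫⁻ p, ‖(F k * g - G * g) p‖ₑ ^ (2 : ℝ) ∂μ) atTop (𝓝 0) := by
    have hdom : MemLp (((2 * K : ℝ) : ℂ) • g) 2 μ := hg.const_smul _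
    have hfin : ∫⁻ p, ‖(((2 * K : ℝ) : ℂ) • g) p‖ₑ ^ (2 : ℝ) ∂μ ≠ ⊤ := by
      have := lintegral_rpow_enorm_lt_top_of_eLpNorm_lt_top (p := 2) (by norm_num) (by norm_num)
        hdom.2
      simpa using this.ne
    have h0 : ∫⁻ _, (0 : ENNReal) ∂μ = 0 := lintegral_zero
    rw [← h0]
    refine tendsto_lintegral_of_dominated_convergence' _
      (fun k => (((hF k).mul hg.1).sub (hG.mul hg.1)).enorm.pow_const _) (fun k => ?_) hfin ?_
    · filter_upwards [hFK k, hGK] with p h1 h2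
      gcongr
      rw [enorm_le_iff_norm_le]
      simp only [Pi.sub_apply, Pi.mul_apply, Pi.smul_apply, smul_eq_mul, ← sub_mul, norm_mul,
        Complex.norm_real]
      gcongr
      calc ‖F k p - G p‖ ≤ ‖F k p‖ + ‖G p‖ := norm_sub_le _ _
        _ ≤ 2 * K := by linarith
        _ ≤ ‖2 * K‖ := le_abs_self _
        _ = ‖(2 : ℝ)‖ * ‖K‖ := norm_mul _ _
    · filter_upwards [hlim] with p h1
      have h2 : Tendsto (fun k => (F k * g - G * g) p) atTop (𝓝 0) := by
        simpa using (h1.mul_const (g p)).sub_const (G p * g p)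
      have h3 := ((ENNReal.continuous_rpow_const (y := (2 : ℝ))).tendsto _).comp h2.enorm
      simpa [Function.comp_def] using h3
  have h4 := ((ENNReal.continuous_rpow_const (y := (1 / 2 : ℝ))).tendsto _).comp hpow
  refine (h4.congr fun k => ?_).trans (by simp)
  simp [eLpNorm_eq_lintegral_rpow_enorm_toReal]

/-- The bounded functions of the momentum which leave invariant the part of a closed real subspace
`Γ` of `H × H` generated by `(x, y)`. -/
noncomputable def multiplierAlgebra (U : Spacetime n → unitary (H →L[ℂ] H))
    (μ : Measure (Spacetime n)) [IsFiniteMeasure μ] {C : Set (Spacetime n)} (hC : μ Cᶜ = 0)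
    (x y : H) (Γ : Submodule ℝ (H × H)) : Subalgebra ℝ (Spacetime n → ℂ) where
  carrier := {G | AEStronglyMeasurable G μ ∧ (∃ K : ℝ, ∀ p ∈ C, ‖G p‖ ≤ K) ∧
    ∀ g, MemLp g 2 μ → (spectralApply U μ x g, spectralApply U μ y g) ∈ Γ →
      (spectralApply U μ x (G * g), spectralApply U μ y (G * g)) ∈ Γ}
  mul_mem' := by
    rintro F G ⟨hF, ⟨K, hFK⟩, hFΓ⟩ ⟨hG, ⟨L, hGL⟩, hGΓ⟩
    refine ⟨hF.mul hG, ⟨K * L, fun p hp => ?_⟩, fun g hg hgΓ => ?_⟩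
    · rw [Pi.mul_apply, norm_mul]
      exact mul_le_mul (hFK p hp) (hGL p hp) (norm_nonneg _) ((norm_nonneg _).trans (hFK p hp))
    · rw [mul_assoc]
      exact hFΓ _ (memLp_mul hG (measure_mono_null (fun p hp hpC => hp (hGL p hpC)) hC) hg)
        (hGΓ g hg hgΓ)
  add_mem' := by
    rintro F G ⟨hF, ⟨K, hFK⟩, hFΓ⟩ ⟨hG, ⟨L, hGL⟩, hGΓ⟩
    refine ⟨hF.add hG, ⟨K + L, fun p hp =>
      (norm_add_le _ _).trans (add_le_add (hFK p hp) (hGL p hp))⟩, fun g hg hgΓ => ?_⟩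
    have h1 := memLp_mul hF (measure_mono_null (fun p hp hpC => hp (hFK p hpC)) hC) hg
    have h2 := memLp_mul hG (measure_mono_null (fun p hp hpC => hp (hGL p hpC)) hC) hg
    rw [add_mul, spectralApply_add h1 h2, spectralApply_add h1 h2]
    exact Γ.add_mem (hFΓ g hg hgΓ) (hGΓ g hg hgΓ)
  algebraMap_mem' c := by
    refine ⟨aestronglyMeasurable_const (b := (c : ℂ)), ⟨‖(c : ℂ)‖, fun _ _ => le_rfl⟩,
      fun g hg hgΓ => ?_⟩
    have h1 : algebraMap ℝ (Spacetime n → ℂ) c * g = (c : ℂ) • g := rfl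
    rw [h1, spectralApply_smul _ hg, spectralApply_smul _ hg]
    have := Γ.smul_mem c hgΓ
    rwa [Prod.smul_mk, ← Complex.coe_smul, ← Complex.coe_smul] at this

variable {U : Spacetime n → unitary (H →L[ℂ] H)} {μ : Measure (Spacetime n)} [IsFiniteMeasure μ]
  {C : Set (Spacetime n)} {x y : H} {Γ : Submodule ℝ (H × H)}

/-- Bounded pointwise limits of multipliers give norm limits of both vectors, and `Γ` is closed.
Behaviour off `C` is irrelevant because `C` has full measure. -/
theorem isBoundedlyClosed_multiplierAlgebra (hC : μ Cᶜ = 0) (hΓ : IsClosed (Γ : Set (H × H))) :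
    IsBoundedlyClosed C (multiplierAlgebra U μ hC x y Γ) := by
  have hae : ∀ P : Spacetime n → Prop, (∀ p ∈ C, P p) → ∀ᵐ p ∂μ, P p := fun P hP =>
    measure_mono_null (fun p hp hpC => hp (hP p hpC)) hC
  refine ⟨fun G hG => hG.2.1, fun F G K hF hFK hlim => ?_⟩
  have hlim' := hae _ hlim
  have hG : AEStronglyMeasurable G μ :=
    aestronglyMeasurable_of_tendsto_ae _ (fun k => (hF k).1) hlim'
  have hGK : ∀ p ∈ C, ‖G p‖ ≤ K := fun p hp =>
    le_of_tendsto (hlim p hp).norm (Eventually.of_forall fun k => hFK k p hp)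
  refine ⟨hG, ⟨K, hGK⟩, fun g hg hgΓ => ?_⟩
  have h1 := tendsto_eLpNorm_mul_sub (fun k => (hF k).1) (fun k => hae _ (hFK k)) hlim' hg
  have h2 : ∀ k, MemLp (F k * g) 2 μ := fun k => memLp_mul (hF k).1 (hae _ (hFK k)) hg
  have h3 : MemLp (G * g) 2 μ := memLp_mul hG (hae _ hGK) hg
  exact hΓ.mem_of_tendsto
    ((tendsto_spectralApply h2 h3 h1).prodMk_nhds (tendsto_spectralApply h2 h3 h1))
    (Eventually.of_forall fun k => (hF k).2.2 g hg hgΓ)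

theorem character_mem_multiplierAlgebra (hC : μ Cᶜ = 0) (hU : IsTranslationRep U)
    (hx : IsDominated U μ x) (hy : IsDominated U μ y) {a : Spacetime n}
    (ha : ∀ q ∈ Γ, ((U a : H →L[ℂ] H) q.1, (U a : H →L[ℂ] H) q.2) ∈ Γ) :
    character a ∈ multiplierAlgebra U μ hC x y Γ := by
  refine ⟨(continuous_character a).aestronglyMeasurable, ⟨1, fun p _ => by simp⟩,
    fun g hg hgΓ => ?_⟩
  rw [spectralApply_character_mul hU hx a hg, spectralApply_character_mul hU hy a hg]
  exact ha _ hgΓ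

end Multipliers

/-! ### Minkowski product, forward cone and mass shell -/

section Geometry

variable {n : ℕ}

theorem minkowski_eq (p a : Spacetime n) :
    minkowski p a = p 0 * a 0 - (p 1 * a 1 + ∑ j : Fin n, p j.succ.succ * a j.succ.succ) := by
  rw [minkowski, Fin.sum_univ_succ]
  rfl

theorem succ_succ_ne_one (j : Fin n) : (j.succ.succ : Fin (n + 2)) ≠ 1 := by
  rw [← Fin.succ_zero_eq_one]
  exact fun h => Fin.succ_ne_zero j (Fin.succ_injective _ h)

theorem continuous_minkowski_self : Continuous fun p : Spacetime n => minkowski p p := by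
  unfold minkowski
  fun_prop

theorem isClosed_forwardCone : IsClosed (forwardCone n) :=
  (isClosed_le (f := fun _ : Spacetime n => (0 : ℝ)) (g := fun p => p 0) continuous_const
    (by fun_prop)).inter (isClosed_le continuous_const continuous_minkowski_self)

theorem isClosed_massShell (m : ℝ) : IsClosed (massShell n m) :=
  (isClosed_le (f := fun _ : Spacetime n => (0 : ℝ)) (g := fun p => p 0) continuous_const
    (by fun_prop)).inter (isClosed_eq continuous_minkowski_self continuous_const)

end Geometry

/-! ### The mass shell projection and the Tomita operator of a wedge algebra -/

section Wedges

open MeasureTheory Filter Topology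

variable {n : ℕ} {H : Type*} [NormedAddCommGroup H] [InnerProductSpace ℂ H] [CompleteSpace H]

namespace WedgeTheory

variable (T : WedgeTheory n H)

theorem isTranslationRep : IsTranslationRep T.U := ⟨T.U_add, T.U_continuous⟩

theorem star_U_Ω (a : Spacetime n) : star (T.U a : H →L[ℂ] H) T.Ω = T.Ω := by
  have h1 : (star (T.U a : H →L[ℂ] H) * (T.U a : H →L[ℂ] H)) T.Ω = T.Ω := by
    rw [Unitary.coe_star_mul_self]
    rfl
  change star (T.U a : H →L[ℂ] H) ((T.U a : H →L[ℂ] H) T.Ω) = T.Ω at h1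
  rwa [T.Ω_invariant] at h1

/-- Translations into the wedge leave the graph of the Tomita operator invariant. -/
theorem translate_mem_tomitaGraph {W : Set (Spacetime n)} (hW : IsWedge W) {a : Spacetime n}
    (ha : (fun x => x + a) '' W ⊆ W) {q : H × H} (hq : q ∈ tomitaGraph (T.alg W) T.Ω) :
    ((T.U a : H →L[ℂ] H) q.1, (T.U a : H →L[ℂ] H) q.2) ∈ tomitaGraph (T.alg W) T.Ω := by
  have hW' : IsWedge ((fun x => x + a) '' W) := by
    obtain ⟨L, c, hL, rfl⟩ := hW
    refine ⟨L, c + a, hL, ?_⟩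
    rw [Set.image_image]
    simp_rw [add_assoc]
  refine map_mem_closure
    (f := fun q : H × H => ((T.U a : H →L[ℂ] H) q.1, (T.U a : H →L[ℂ] H) q.2))
    (by fun_prop) hq ?_
  rintro _ ⟨A, hA, rfl⟩
  -- The witness is `U A U*`, which lies in the algebra of `W + a ⊆ W`; by invariance of the vacuum
  -- it sends `Ω` to `U A Ω`, and its adjoint sends `Ω` to `U A* Ω`.
  refine ⟨_, T.isotony _ _ hW' hW ha ((T.covariance W hW a A).1 hA), ?_⟩
  have h1 := T.star_U_Ω a
  simp only [star_mul, star_star, mul_assoc]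
  refine Prod.ext ?_ ?_
  · change _ = (T.U a : H →L[ℂ] H) (A (star (T.U a : H →L[ℂ] H) T.Ω))
    rw [h1]
  · change _ = (T.U a : H →L[ℂ] H) (star A (star (T.U a : H →L[ℂ] H) T.Ω))
    rw [h1]

/-- Finitely many vectors have a common dominating measure supported in the forward cone. -/
theorem exists_isDominated {k : ℕ} (x : Fin k → H) :
    ∃ μ : Measure (Spacetime n), IsFiniteMeasure μ ∧ μ (forwardCone n)ᶜ = 0 ∧
      ∀ i, IsDominated T.U μ (x i) := by
  choose ν hν hνx using fun i => T.isTranslationRep.exists_isSpectralMeasure (x i)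
  refine ⟨Measure.sum ν, inferInstance, ?_, fun i => ⟨ν i, Measure.le_sum ν i, hνx i⟩⟩
  rw [Measure.sum_apply_eq_zero]
  exact fun i => (T.spectrum (x i)).measure_compl_eq_zero T.isTranslationRep (hνx i)
    isClosed_forwardCone

theorem memLp_indicator_massShell {μ : Measure (Spacetime n)} [IsFiniteMeasure μ] (m : ℝ) :
    MemLp ((massShell n m).indicator (1 : Spacetime n → ℂ)) 2 μ :=
  (memLp_const 1).indicator (isClosed_massShell m).measurableSet

/-- The projection onto the mass shell leaves the graph of the Tomita operator of a wedge algebra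
invariant. -/
theorem spectralApply_massShell_mem_tomitaGraph {W : Set (Spacetime n)} (hW : IsWedge W) (m : ℝ)
    {μ : Measure (Spacetime n)} [IsFiniteMeasure μ] (hμ : μ (forwardCone n)ᶜ = 0) {x y : H}
    (hx : IsDominated T.U μ x) (hy : IsDominated T.U μ y)
    (hxy : (x, y) ∈ tomitaGraph (T.alg W) T.Ω) :
    (spectralApply T.U μ x ((massShell n m).indicator 1),
      spectralApply T.U μ y ((massShell n m).indicator 1)) ∈ tomitaGraph (T.alg W) T.Ω := by
  set Γ := tomitaGraph (T.alg W) T.Ω with hΓ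
  have hcl := isBoundedlyClosed_multiplierAlgebra (U := T.U) (x := x) (y := y) hμ
    (isClosed_tomitaGraph (T.alg W) T.Ω)
  obtain ⟨L, c, hL, hWL⟩ := id hW
  have htrans : ∀ b : Spacetime n, (∀ z ∈ standardWedge n, z + b ∈ standardWedge n) →
      character (L b) ∈ multiplierAlgebra T.U μ hμ x y Γ := by
    intro b hb
    refine character_mem_multiplierAlgebra hμ T.isTranslationRep hx hy fun q hq =>
      T.translate_mem_tomitaGraph hW ?_ hq
    rw [hWL, Set.image_image]
    rintro _ ⟨z, hz, rfl⟩
    refine ⟨z + b, hb z hz, ?_⟩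
    simp only [map_add]
    abel
  have hchar : ∀ b p, character (L b) p =
      Complex.exp (Complex.I * ((minkowski (L.symm p) b : ℝ) : ℂ)) := by
    intro b p
    rw [character, ← hL (L.symm p) b, LinearEquiv.apply_symm_apply]
  -- Light-cone coordinates of the momentum in the frame of `W`. Since `L` may reverse time, `u` and
  -- `v` need not be nonnegative on the forward cone, but `u v = p² + Σ w²` is.
  set u : Spacetime n → ℝ := fun p => L.symm p 0 - L.symm p 1 with hu
  set v : Spacetime n → ℝ := fun p => L.symm p 0 + L.symm p 1 with hv
  set w : Fin n → Spacetime n → ℝ := fun j p => -L.symm p j.succ.succ with hw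
  have huvw : ∀ p, u p * v p - ∑ j, w j p ^ 2 = minkowski p p := by
    intro p
    rw [← LinearEquiv.apply_symm_apply L p, hL, minkowski_eq]
    simp only [hu, hv, hw, LinearEquiv.symm_apply_apply, neg_sq]
    simp only [sq]
    ring
  have h1 := hcl.indicator_mem (u := u) (v := v) (w := w) (fun t ht => ?_) (fun t ht => ?_)
    (fun j t => ?_) (fun p hp => ?_) (m ^ 2)
  -- The hyperboloid `p² = m²` meets the forward cone exactly in the mass shell. The resulting
  -- multiplier is then applied to the constant function `1`, which represents `x` and `y`
  -- themselves.
  · have h2 := hcl.congr (G := (massShell n m).indicator 1) h1 fun p hp => by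
      by_cases hm : minkowski p p = m ^ 2
      · rw [Set.indicator_of_mem (by simpa [huvw] using hm), 
          Set.indicator_of_mem (show p ∈ massShell n m from ⟨hp.1, hm⟩)]
      · rw [Set.indicator_of_notMem (by simpa [huvw] using hm),
          Set.indicator_of_notMem fun h => hm h.2]
    have h3 := h2.2.2 1 (memLp_const 1) (by
      rwa [spectralApply_one T.isTranslationRep hx, spectralApply_one T.isTranslationRep hy])
    rwa [mul_one] at h3
  -- The lightlike edge directions `e₁ ± e₀` of the wedge, with `t ≥ 0`, produce the phases `exp(i t
  -- u)` and `exp(-i t v)`; transverse directions are allowed with either sign.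
  · have h2 := htrans (t • (EuclideanSpace.single 0 1 + EuclideanSpace.single 1 1)) fun z hz => by
      simp only [standardWedge, Set.mem_ofPred_eq, abs_lt] at hz ⊢
      simp
      constructor <;> linarith
    convert! h2 using 1
    ext p
    rw [hchar, minkowski_eq]
    congr 3
    simp [hu, succ_succ_ne_one]
    ring
  · have h2 := htrans (t • (EuclideanSpace.single 1 1 - EuclideanSpace.single 0 1)) fun z hz => by
      simp only [standardWedge, Set.mem_ofPred_eq, abs_lt] at hz ⊢
      simp
      constructor <;> linarith
    convert! h2 using 1
    ext p
    rw [hchar, minkowski_eq]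
    congr 3
    simp [hv, succ_succ_ne_one]
    ring
  · have h2 := htrans (t • EuclideanSpace.single j.succ.succ 1) fun z hz => by
      simp only [standardWedge, Set.mem_ofPred_eq] at hz ⊢
      simpa [(Fin.succ_ne_zero j.succ).symm, (succ_succ_ne_one j).symm] using hz
    convert! h2 using 1
    ext p
    rw [hchar, minkowski_eq]
    congr 3
    simp [hw, (Fin.succ_ne_zero j.succ).symm, (succ_succ_ne_one j).symm, mul_comm]
  · have h2 := huvw p
    have h3 : 0 ≤ ∑ j, w j p ^ 2 := by positivity
    have h4 := hp.2
    linarith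

/-- The projection onto the mass shell. -/
theorem hasMomentumIn_spectralApply_massShell {μ : Measure (Spacetime n)} [IsFiniteMeasure μ]
    {x : H} (hx : IsDominated T.U μ x) (m : ℝ) :
    HasMomentumIn T.U (massShell n m)
      (spectralApply T.U μ x ((massShell n m).indicator 1)) := by
  intro f hf
  rw [integral_smul_spectralApply T.isTranslationRep hx (memLp_indicator_massShell m) f]
  have h1 : lorentzFourier f * (massShell n m).indicator 1 = (0 : ℂ) • 1 := by
    ext p
    by_cases hp : p ∈ massShell n m
    · have := hf p hp
      change lorentzFourier f p = 0 at this
      simp [this]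
    · simp [hp]
  have h2 : MemLp (1 : Spacetime n → ℂ) 2 μ := memLp_const 1
  rw [h1, spectralApply_smul _ h2, zero_smul]

theorem spectralApply_massShell_eq_self {μ : Measure (Spacetime n)} [IsFiniteMeasure μ]
    {x : H} (hx : IsDominated T.U μ x) {m : ℝ} (hm : HasMomentumIn T.U (massShell n m) x) :
    spectralApply T.U μ x ((massShell n m).indicator 1) = x := by
  obtain ⟨ν, hνμ, hν⟩ := hx
  have := isFiniteMeasure_of_le μ hνμ
  nth_rw 2 [← spectralApply_one T.isTranslationRep ⟨ν, hνμ, hν⟩]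
  refine spectralApply_congr T.isTranslationRep hνμ hν (memLp_indicator_massShell m)
    (memLp_const 1) ?_
  have h0 := hm.measure_compl_eq_zero T.isTranslationRep hν (isClosed_massShell m)
  filter_upwards [compl_mem_ae_iff.2 h0] with p hp
  rw [compl_compl] at hp
  simp [hp]

theorem inner_Ω_snd {W : Set (Spacetime n)} {q : H × H}
    (hq : q ∈ tomitaGraph (T.alg W) T.Ω) : ⟪T.Ω, q.1⟫_ℂ = ⟪q.2, T.Ω⟫_ℂ := by
  simpa using inner_commutant_of_mem_tomitaGraph hq (one_mem (T.alg W).commutant)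

/-- The Tomita operator of a wedge algebra leaves the one-particle space invariant. -/
theorem snd_mem_oneParticle {W : Set (Spacetime n)} (hW : IsWedge W) {m : ℝ} {q : H × H}
    (hq : q ∈ tomitaGraph (T.alg W) T.Ω) (h1 : q.1 ∈ T.oneParticle m) :
    q.2 ∈ T.oneParticle m := by
  obtain ⟨x, y⟩ := q
  obtain ⟨μ, hμ, hμC, hd⟩ := T.exists_isDominated ![x, y]
  have hx : IsDominated T.U μ x := hd 0
  have hy : IsDominated T.U μ y := hd 1
  have h2 := T.spectralApply_massShell_mem_tomitaGraph hW m hμC hx hy hq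
  rw [T.spectralApply_massShell_eq_self hx h1.1] at h2
  -- With `E` the mass shell projection and `E x = x`, the graph contains `(x, E y) - (x, y) = (0, E
  -- y - y)`.
  have h3 := snd_eq_zero_of_mem_tomitaGraph (T.separating W hW) (Submodule.sub_mem _ h2 hq)
    (sub_self x)
  have h4 : spectralApply T.U μ y ((massShell n m).indicator 1) = y := sub_eq_zero.1 h3
  refine ⟨?_, ?_⟩
  · have := T.hasMomentumIn_spectralApply_massShell hy m
    rwa [h4] at this
  · have := T.inner_Ω_snd hq
    rw [h1.2] at this
    rw [← inner_conj_symm, ← this, map_zero]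

/-- The domain of the Tomita operator of a wedge algebra is dense in the one-particle space. -/
theorem oneParticle_subset_closure {W : Set (Spacetime n)} (hW : IsWedge W) (m : ℝ) :
    T.oneParticle m ⊆
      closure (T.oneParticle m ∩ ((tomitaOperator (T.alg W) T.Ω).domain : Set H)) := by
  intro Φ hΦ
  rw [Metric.mem_closure_iff]
  intro ε hε
  obtain ⟨_, ⟨A, hA, rfl⟩, hdist⟩ := Metric.mem_closure_iff.1 (T.cyclic W hW Φ) (ε / 2) (half_pos hε)
  -- Removing the vacuum component matters for `m = 0`, where the mass shell contains the momentum
  -- `0`. As `Φ ⊥ Ω`, it at most doubles the error, whence `ε / 2` above.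
  have hB : A - ⟪T.Ω, A T.Ω⟫_ℂ • 1 ∈ T.alg W :=
    sub_mem hA ((T.alg W).toStarSubalgebra.smul_mem (one_mem (T.alg W)) _)
  set B := A - ⟪T.Ω, A T.Ω⟫_ℂ • 1 with hBdef
  have hBΩ : B T.Ω = A T.Ω - ⟪T.Ω, A T.Ω⟫_ℂ • T.Ω := rfl
  have hΩΩ : ⟪T.Ω, T.Ω⟫_ℂ = 1 := by
    rw [inner_self_eq_norm_sq_to_K, T.Ω_norm]
    simp
  have hBorth : ⟪T.Ω, B T.Ω⟫_ℂ = 0 := by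
    rw [hBΩ, inner_sub_right, inner_smul_right, hΩΩ, mul_one, sub_self]
  have hBdist : ‖B T.Ω - Φ‖ < ε := by
    have h1 : B T.Ω - Φ = (A T.Ω - Φ) - ⟪T.Ω, A T.Ω - Φ⟫_ℂ • T.Ω := by
      rw [hBΩ, inner_sub_right, hΦ.2, sub_zero]
      abel
    have h2 : ‖⟪T.Ω, A T.Ω - Φ⟫_ℂ • T.Ω‖ ≤ ‖A T.Ω - Φ‖ := by
      rw [norm_smul, T.Ω_norm, mul_one]
      have h3 := norm_inner_le_norm (𝕜 := ℂ) T.Ω (A T.Ω - Φ)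
      rwa [T.Ω_norm, one_mul] at h3
    rw [dist_comm, dist_eq_norm] at hdist
    rw [h1]
    refine (norm_sub_le _ _).trans_lt ?_
    linarith
  have hmem : (B T.Ω, star B T.Ω) ∈ tomitaGraph (T.alg W) T.Ω := subset_closure ⟨B, hB, rfl⟩
  obtain ⟨μ, hμ, hμC, hd⟩ := T.exists_isDominated ![B T.Ω, star B T.Ω, Φ, B T.Ω - Φ]
  have hx : IsDominated T.U μ (B T.Ω) := hd 0
  have hy : IsDominated T.U μ (star B T.Ω) := hd 1
  have hΦd : IsDominated T.U μ Φ := hd 2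
  have hxΦ : IsDominated T.U μ (B T.Ω - Φ) := hd 3
  refine ⟨spectralApply T.U μ (B T.Ω) ((massShell n m).indicator 1),
    ⟨⟨T.hasMomentumIn_spectralApply_massShell hx m, ?_⟩,
    mem_domain_of_mem_tomitaGraph (T.separating W hW)
      (T.spectralApply_massShell_mem_tomitaGraph hW m hμC hx hy hmem)⟩, ?_⟩
  -- The orthogonal complement of `Ω` is closed and contains all `U(a) B Ω`, so it also contains the
  -- projected vector.
  · refine Submodule.mem_orthogonal_singleton_iff_inner_right.1 (spectralApply_mem
      T.isTranslationRep hx (memLp_indicator_massShell m) (Submodule.isClosed_orthogonal _)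
      fun a => Submodule.mem_orthogonal_singleton_iff_inner_right.2 ?_)
    rw [← ContinuousLinearMap.adjoint_inner_left, ← ContinuousLinearMap.star_eq_adjoint,
      T.star_U_Ω, hBorth]
  · rw [dist_comm, dist_eq_norm]
    nth_rw 1 [← T.spectralApply_massShell_eq_self hΦd hΦ.1]
    rw [← spectralApply_sub_vector T.isTranslationRep hx hΦd hxΦ (memLp_indicator_massShell m)]
    refine (norm_spectralApply_le T.isTranslationRep hxΦ (memLp_indicator_massShell m)
      fun p => ?_).trans_lt hBdist
    by_cases hp : p ∈ massShell n m <;> simp [hp]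

end WedgeTheory

end Wedges

theorem mainTheorem4 {H : Type*} [NormedAddCommGroup H] [InnerProductSpace ℂ H]
    [CompleteSpace H] :
    -- the general theorem of modular theory
    (∀ (M : VonNeumannAlgebra H) (Ω : H), IsCyclicVector M Ω → IsSeparatingVector M Ω →
      ∀ Φ : (tomitaOperator M Ω).domain, ∃ F : H →ₗ.[ℂ] H,
        Dense (F.domain : Set H) ∧ F.IsClosed ∧ IsAffiliated F M ∧
        ∃ (h : Ω ∈ F.domain) (h' : Ω ∈ F†.domain),
          F ⟨Ω, h⟩ = Φ ∧ F† ⟨Ω, h'⟩ = tomitaOperator M Ω Φ) ∧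
    -- existence of polarization-free generators
    (∀ (n : ℕ) (T : WedgeTheory n H) (W : Set (Spacetime n)), IsWedge W → ∀ m : ℝ, 0 ≤ m →
      T.oneParticle m ⊆
        closure (T.oneParticle m ∩ ((tomitaOperator (T.alg W) T.Ω).domain : Set H)) ∧
      ∀ Φ : (tomitaOperator (T.alg W) T.Ω).domain, (Φ : H) ∈ T.oneParticle m →
        ∃ (G : H →ₗ.[ℂ] H) (hG : T.IsPFG W m G),
          G ⟨T.Ω, hG.mem_domain⟩ = Φ ∧
          G† ⟨T.Ω, hG.mem_adjoint_domain⟩ = tomitaOperator (T.alg W) T.Ω Φ) := by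
  refine ⟨fun M Ω _ hs Φ => exists_affiliated_of_mem_tomitaGraph hs
    (mem_tomitaGraph_of_domain hs Φ), fun n T W hW m _ =>
    ⟨T.oneParticle_subset_closure hW m, fun Φ hΦ => ?_⟩⟩
  have hmem := mem_tomitaGraph_of_domain (T.separating W hW) Φ
  obtain ⟨G, hd, hcl, haff, h, h', h1, h2⟩ :=
    exists_affiliated_of_mem_tomitaGraph (T.separating W hW) hmem
  exact ⟨G, ⟨hd, hcl, haff, h, h', h1 ▸ hΦ, h2 ▸ T.snd_mem_oneParticle hW hmem hΦ⟩, h1, h2⟩
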